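/- Let $a(z)=\dfrac{4(z+1)^3}{27z}=\sum_{k=-q}^{p}a_kz^k$, so that $p=2$, $q=1$, $a_{p}\ne 0\ne a_{-q}$ and $\gcd\{k: a_k\neq 0\}=1$. For $\lambda\in\mathbb C$ let $z_1(\lambda),z_2(\lambda),z_3(\lambda)$ be the $p+q=3$ solutions, counted with multiplicity, of $a(z)=\lambda$, ordered so that $0<|z_1(\lambda)|\le|z_2(\lambda)|\le|z_3(\lambda)|$ (with an arbitrary numbering if equalities occur). For $k=0,1$ put $$\Gamma_k=\{\lambda\in\mathbb C : |z_{q+k}(\lambda)|=|z_{q+k+1}(\lambda)|\},$$ and let $\mu_k$ be the measure on $\Gamma_k$ given by $$d\mu_k(\lambda)=\frac1{2\pi i}\sum_{j=1}^{q+k}\left(\frac{z_{j+}'(\lambda)}{z_{j+}(\lambda)}-\frac{z_{j-}'(\lambda)}{z_{j-}(\lambda)}\right)d\lambda ,$$ where $\Gamma_k$ is, up to a finite set of exceptional points (which carries no mass), a finite disjoint union of oriented open analytic arcs, $d\lambda$ is the complex line element along these arcs, and the subscripts $+$ and $-$ denote limiting values from the left and from the right side of the arc; the result does not depend on the choice of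 the arcs and of their orientation. Then, with positive real roots of positive numbers throughout, $\mu_0$ and $\mu_1$ exist as positive measures, and: 1. $\Gamma_0=[0,1]$, and $\mu_0$ is the measure on $[0,1]$ with $$d\mu_0(\lambda)=\frac{\sqrt3}{4\pi}\,\frac{\left(1+\sqrt{1-\lambda}\right)^{1/3}+\left(1-\sqrt{1-\lambda}\right)^{1/3}}{\lambda^{2/3}\sqrt{1-\lambda}}\,d\lambda .$$ 2. $\Gamma_1=(-\infty,0]$, and $\mu_1$ is the measure on $(-\infty,0]$ with $$d\mu_1(\lambda)=\frac{\sqrt3}{4\pi}\,\frac{\left(1+\sqrt{1-\lambda}\right)^{1/3}-\left(\sqrt{1-\lambda}-1\right)^{1/3}}{(-\lambda)^{2/3}\sqrt{1-\lambda}}\,d\lambda .$$ -/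

import Mathlib

namespace BandedToeplitz

open Set Filter Topology MeasureTheory

/-- The Laurent polynomial `a(z) = ∑_{k=-q}^{p} a_k z^k` with `p, q ≥ 1`, `a_p ≠ 0`, `a_{-q} ≠ 0`
and `gcd {k : a_k ≠ 0} = 1`. -/
structure IsBandedSymbol (p q : ℕ) (a : LaurentPolynomial ℂ) : Prop where
  one_le_p : 1 ≤ p
  one_le_q : 1 ≤ q
  coeff_p : a.coeff (p : ℤ) ≠ 0
  coeff_q : a.coeff (-(q : ℤ)) ≠ 0
  coeff_eq_zero : ∀ k : ℤ, k < -(q : ℤ) ∨ (p : ℤ) < k → a.coeff k = 0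
  gcd_eq_one : a.coeff.support.gcd id = 1

/-- The polynomial `z^q (a(z) - λ)`, of degree `p + q` and nonzero at `0`. Its roots, with
multiplicity, are the solutions of `a(z) = λ`. -/
noncomputable def solutionPoly (p q : ℕ) (a : LaurentPolynomial ℂ) (lam : ℂ) : Polynomial ℂ :=
  ∑ n ∈ Finset.range (p + q + 1),
      Polynomial.C (a.coeff ((n : ℤ) - (q : ℤ))) * Polynomial.X ^ n
    - Polynomial.C lam * Polynomial.X ^ q

/-- For every `λ`, the numbers `z_1(λ), …, z_{p+q}(λ)` are the solutions of `a(z) = λ`, listed with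
multiplicity and ordered by absolute value. Ties are broken arbitrarily. The values `z_j` for other
indices `j` are irrelevant. -/
def IsOrderedSolutions (p q : ℕ) (a : LaurentPolynomial ℂ) (z : ℤ → ℂ → ℂ) : Prop :=
  ∀ lam : ℂ,
    (Finset.Icc (1 : ℤ) ((p : ℤ) + q)).val.map (fun j => z j lam)
        = (solutionPoly p q a lam).roots ∧
    ∀ i j : ℤ, 1 ≤ i → i ≤ j → j ≤ (p : ℤ) + q → ‖z i lam‖ ≤ ‖z j lam‖

/-- `Γ_k = {λ ∈ ℂ : |z_{q+k}(λ)| = |z_{q+k+1}(λ)|}`, for `-q+1 ≤ k ≤ p-1`. -/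
def Gam (q : ℕ) (z : ℤ → ℂ → ℂ) (k : ℤ) : Set ℂ :=
  {lam | ‖z ((q : ℤ) + k) lam‖ = ‖z ((q : ℤ) + k + 1) lam‖}

/-- `γ`, restricted to `(0,1)`, parametrizes an oriented open analytic arc in `ℂ`. -/
structure IsAnalyticArc (γ : ℝ → ℂ) : Prop where
  analytic : AnalyticOnNhd ℝ γ (Ioo 0 1)
  deriv_ne_zero : ∀ t ∈ Ioo (0 : ℝ) 1, deriv γ t ≠ 0
  embedding : IsEmbedding ((Ioo (0 : ℝ) 1).domRestrict γ)

/-- Points `λ'` that tend to `γ t` from the `+`-side (left) of the arc `γ`. In the coordinates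
`(u, s) ↦ γ u + i s γ' u`, which are a local diffeomorphism at `(t, 0)`, the left side of the arc is
`s > 0`. -/
noncomputable def plusSide (γ : ℝ → ℂ) (t : ℝ) : Filter ℂ :=
  Filter.map (fun u : ℝ × ℝ => γ u.1 + Complex.I * (u.2 : ℂ) * deriv γ u.1)
    (𝓝 t ×ˢ 𝓝[>] (0 : ℝ))

/-- Points `λ'` that tend to `γ t` from the `-`-side (right) of the arc `γ`. -/
noncomputable def minusSide (γ : ℝ → ℂ) (t : ℝ) : Filter ℂ :=
  Filter.map (fun u : ℝ × ℝ => γ u.1 + Complex.I * (u.2 : ℂ) * deriv γ u.1)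
    (𝓝 t ×ˢ 𝓝[<] (0 : ℝ))

/-- As `λ'` tends to a point along the filter `l` (one side of an arc), the function `f` is
holomorphic with limiting value `v`, and its derivative has limiting value `v'`. -/
def HasSideValues (f : ℂ → ℂ) (l : Filter ℂ) (v v' : ℂ) : Prop :=
  (∀ᶠ lam in l, DifferentiableAt ℂ f lam) ∧ Tendsto f l (𝓝 v) ∧ Tendsto (deriv f) l (𝓝 v')

/-- The real number `h` is the value at the parameter `t` of
`(1 / 2πi) ∑_{j=1}^{q+k} (z_j'₊ / z_j₊ - z_j'₋ / z_j₋) dλ`, where `dλ = γ'(t) dt`. In particular the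
one-sided limiting values exist. -/
def IsArcDensity (q : ℕ) (z : ℤ → ℂ → ℂ) (k : ℤ) (γ : ℝ → ℂ) (t h : ℝ) : Prop :=
  ∃ vp vp' vm vm' : ℤ → ℂ,
    (∀ j ∈ Finset.Icc (1 : ℤ) ((q : ℤ) + k),
      HasSideValues (z j) (plusSide γ t) (vp j) (vp' j) ∧
      HasSideValues (z j) (minusSide γ t) (vm j) (vm' j)) ∧
    (h : ℂ) = 1 / (2 * (Real.pi : ℂ) * Complex.I) *
      (∑ j ∈ Finset.Icc (1 : ℤ) ((q : ℤ) + k), (vp' j / vp j - vm' j / vm j)) * deriv γ t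

/-- `μ` is the (positive) measure `μ_k` on `Γ_k` given by
`dμ_k(λ) = (1 / 2πi) ∑_{j=1}^{q+k} (z_j'₊(λ) / z_j₊(λ) - z_j'₋(λ) / z_j₋(λ)) dλ`:
up to a finite set `E` of exceptional points, which carries no mass, `Γ_k` is a finite disjoint union
of oriented open analytic arcs, along each of which `μ` has the density on the right-hand side. -/
def IsMu (q : ℕ) (z : ℤ → ℂ → ℂ) (k : ℤ) (μ : Measure ℂ) : Prop :=
  ∃ (E : Set ℂ) (m : ℕ) (γ : Fin m → ℝ → ℂ) (h : Fin m → ℝ → ℝ),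
    E.Finite ∧
    (∀ i, IsAnalyticArc (γ i)) ∧
    (∀ i, Disjoint E (γ i '' Ioo 0 1)) ∧
    (∀ i j, i ≠ j → Disjoint (γ i '' Ioo 0 1) (γ j '' Ioo 0 1)) ∧
    Gam q z k = E ∪ ⋃ i, γ i '' Ioo 0 1 ∧
    (∀ i, ∀ t ∈ Ioo (0 : ℝ) 1, 0 ≤ h i t ∧ IsArcDensity q z k (γ i) t (h i t)) ∧
    μ = ∑ i, Measure.map (γ i)
      ((volume.restrict (Ioo (0 : ℝ) 1)).withDensity (fun t => ENNReal.ofReal (h i t)))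

/-- The measure on `ℂ` that is carried by the real set `s` and has density `f` with respect to
Lebesgue measure there. -/
noncomputable def realDensityMeasure (s : Set ℝ) (f : ℝ → ℝ) : Measure ℂ :=
  Measure.map (fun x : ℝ => (x : ℂ))
    ((volume.restrict s).withDensity (fun x => ENNReal.ofReal (f x)))

/-- The symbol `a(z) = 4 (z + 1)^3 / (27 z)`. -/
noncomputable def cubicSymbol : LaurentPolynomial ℂ :=
  LaurentPolynomial.C (4 / 27) * (LaurentPolynomial.T 1 + 1) ^ 3 * LaurentPolynomial.T (-1)

end BandedToeplitz

namespace BandedToeplitz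

open Set Filter Topology MeasureTheory

/-! Write `s² = 1 - λ`, `α³ = 1 + s`, `β³ = 1 - s`, so that `α³ + β³ = 2` and `α³β³ = λ`. If `w³ =
1` and `u = α + wβ`, then `u³ = 2 + 3wαβu`, so `z = -u³/2` satisfies `z + 1 = -(3/2)wαβu` and hence
`4(z + 1)³ = 27λz`. The three cube roots of unity `w` thus give all solutions
(`roots_solutionPoly`).

Since `|α + wβ|² = |α|² + |β|² + 2 Re(P w̄)` with `P = α β̄`, the order of the moduli depends on `P`
only. Two moduli agree only if `P` lies on one of three lines through `0`, and then `Im P³ = 0`. But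
`P³ = (1 + s)(1 - s̄)` has imaginary part `2 Im s`, so a coincidence forces `s` to be real, i.e. `λ
≤ 1`. For real `λ ≤ 1` one may take `P` real with `P³ = λ`, and the sign of `λ` decides which pair
coincides; this gives both sets `Γ_k`.

Off the real axis, `Im P` has the sign opposite to `Im λ` near a real `x < 1`, `x ≠ 0`. Crossing the
axis therefore exchanges the solutions for `w = ω` and `w = ω²` (`ω` a primitive cube root of
unity), while the one for `w = 1` keeps its place. With `z'/z = (wα - w²β)/(2s(αβ)²)`
(`IsBranchAt.deriv_div`), both jumps equal `i√3(α + β)/(2s(αβ)²)`, which is the density up to `2πi`.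

The definition of `μ_k` allows any decomposition into arcs. When `Γ_k` is real,
`isMu_iff_eq_realDensityMeasure` reduces it to the jump across the real axis: change of variables
shows that every decomposition gives the same measure, and a single arc shows that one exists. -/

/-! ### The symbol and its polynomial -/

open LaurentPolynomial in
theorem cubicSymbol_eq : cubicSymbol =
    C (4 / 27) * T 2 + C (12 / 27) * T 1 + C (12 / 27) * T 0 + C (4 / 27) * T (-1) := by
  unfold cubicSymbol
  have h2 : (T 2 : LaurentPolynomial ℂ) = T 1 * T 1 := by rw [← T_add]; rfl
  have h0 : (T 1 * T (-1) : LaurentPolynomial ℂ) = 1 := by rw [← T_add]; simp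
  have h3 : (C (12/27) : LaurentPolynomial ℂ) = 3 * C (4/27) := by
    rw [show (12/27 : ℂ) = 3 * (4/27) by norm_num, map_mul, map_ofNat]
  rw [h2, h3, T_zero]
  linear_combination (C (4/27) * (T 1 ^ 2 + 3 * T 1 + 3)) * h0

theorem coeff_cubicSymbol (k : ℤ) : cubicSymbol.coeff k =
    if k = 2 then 4 / 27 else if k = 1 then 12 / 27 else if k = 0 then 12 / 27
      else if k = -1 then 4 / 27 else 0 := by
  have key : ∀ (r : ℂ) (n : ℤ), (LaurentPolynomial.C r * LaurentPolynomial.T n).coeff k =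
      if k = n then r else 0 := by
    intro r n
    rw [← LaurentPolynomial.single_eq_C_mul_T, AddMonoidAlgebra.coeff_single, Finsupp.single_apply]
    simp only [eq_comm]
  rw [cubicSymbol_eq]
  simp only [AddMonoidAlgebra.coeff_add, Finsupp.add_apply, key]
  split_ifs <;> first | omega | norm_num

theorem isBandedSymbol_cubicSymbol : IsBandedSymbol 2 1 cubicSymbol where
  one_le_p := by norm_num
  one_le_q := le_rfl
  coeff_p := by rw [coeff_cubicSymbol]; norm_num
  coeff_q := by rw [coeff_cubicSymbol]; norm_num
  coeff_eq_zero k hk := by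
    rw [coeff_cubicSymbol]
    push_cast at hk
    split_ifs <;> first | omega | rfl
  gcd_eq_one := by
    have h1 : cubicSymbol.coeff.support.gcd id ∣ (1 : ℤ) := by
      apply Finset.gcd_dvd (f := id)
      rw [Finsupp.mem_support_iff, coeff_cubicSymbol]
      norm_num
    rw [← Finset.normalize_gcd]
    exact normalize_eq_one.2 (isUnit_of_dvd_one h1)

theorem solutionPoly_cubicSymbol (lam : ℂ) : solutionPoly 2 1 cubicSymbol lam =
    Polynomial.C (4 / 27) * ((Polynomial.X + 1) ^ 3
      - Polynomial.C (27 / 4 * lam) * Polynomial.X) := by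
  have h3 : (Polynomial.C (4 / 9) : Polynomial ℂ) = 3 * Polynomial.C (4/27) := by
    rw [show (4 / 9 : ℂ) = 3 * (4/27) by norm_num, map_mul, map_ofNat]
  have h4 : (Polynomial.C (4/27) * Polynomial.C (27 / 4 * lam) : Polynomial ℂ) =
      Polynomial.C lam := by
    rw [← map_mul]; congr 1; ring
  simp only [solutionPoly, coeff_cubicSymbol, Finset.sum_range_succ, Finset.sum_range_zero]
  norm_num
  rw [map_mul] at h4
  rw [h3]
  linear_combination Polynomial.X * h4

/-! ### Explicit solutions of the cubic -/

/-- A primitive cube root of unity. -/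
noncomputable def cubeRoot : ℂ := ⟨-1 / 2, Real.sqrt 3 / 2⟩

theorem cubeRoot_re : cubeRoot.re = -1 / 2 := rfl

theorem cubeRoot_im : cubeRoot.im = Real.sqrt 3 / 2 := rfl

theorem cubeRoot_sq_add : cubeRoot ^ 2 + cubeRoot + 1 = 0 := by
  have h := Real.sq_sqrt (show (0 : ℝ) ≤ 3 by norm_num)
  apply Complex.ext
  · simp [pow_two, cubeRoot_re, cubeRoot_im]; nlinarith
  · simp [pow_two, cubeRoot_re, cubeRoot_im]; ring

theorem cubeRoot_pow_three : cubeRoot ^ 3 = 1 := by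
  linear_combination (cubeRoot - 1) * cubeRoot_sq_add

theorem cubeRoot_sub_sq : cubeRoot - cubeRoot ^ 2 = Complex.I * (Real.sqrt 3 : ℂ) := by
  have h : cubeRoot - cubeRoot ^ 2 = 2 * cubeRoot + 1 := by
    linear_combination -cubeRoot_sq_add
  rw [h]
  apply Complex.ext
  · simp [cubeRoot_re]; norm_num
  · simp [cubeRoot_im]; ring

/-- `-(α + w β)³ / 2`: for `w³ = 1`, a solution of `4 (z + 1)³ = 27 α³ β³ z` if `α³ + β³ = 2`. -/
noncomputable def cubicSol (w al be : ℂ) : ℂ := -(1 / 2) * (al + w * be) ^ 3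

/-- With `a = α²β` and `b = αβ²` the solutions are `-(1 + (3/2)(wa + w²b))`, and the product over
`w` is the factorization of `y³ + A³ + B³ - 3ABy` for `y = x + 1`, `A = 3a/2`, `B = 3b/2`. Comparing
with the cubic needs only `ab = λ` and `a³ + b³ = 2λ`. -/
theorem roots_solutionPoly {lam al be : ℂ} (hadd : al ^ 3 + be ^ 3 = 2)
    (hmul : al ^ 3 * be ^ 3 = lam) :
    (solutionPoly 2 1 cubicSymbol lam).roots =
      {cubicSol 1 al be, cubicSol cubeRoot al be, cubicSol (cubeRoot ^ 2) al be} := by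
  have hw := cubeRoot_sq_add
  have h3 := cubeRoot_pow_three
  have hsol : ∀ w : ℂ, w ^ 3 = 1 → cubicSol w al be =
      -(1 + 3 / 2 * (w * (al ^ 2 * be) + w ^ 2 * (al * be ^ 2))) := by
    intro w hw
    unfold cubicSol
    linear_combination (-1 / 2) * hadd - be ^ 3 / 2 * hw
  set a := al ^ 2 * be with ha
  set b := al * be ^ 2 with hb
  have hab : a * b = lam := by rw [ha, hb, ← hmul]; ring
  have hab3 : a ^ 3 + b ^ 3 = 2 * lam := by
    rw [ha, hb, ← hmul]; linear_combination al ^ 3 * be ^ 3 * hadd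
  rw [solutionPoly_cubicSymbol, Polynomial.roots_C_mul _ (by norm_num)]
  have hprod : ((Polynomial.X + 1) ^ 3 - Polynomial.C (27 / 4 * lam) * Polynomial.X) =
      (({cubicSol 1 al be, cubicSol cubeRoot al be,
        cubicSol (cubeRoot ^ 2) al be} : Multiset ℂ).map
          fun r => Polynomial.X - Polynomial.C r).prod := by
    apply Polynomial.funext
    intro x
    simp only [Multiset.insert_eq_cons, Multiset.map_cons, Multiset.map_singleton,
      Multiset.prod_cons, Multiset.prod_singleton, Polynomial.eval_mul, Polynomial.eval_sub,
      Polynomial.eval_pow, Polynomial.eval_add, Polynomial.eval_X, Polynomial.eval_one,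
      Polynomial.eval_C]
    rw [hsol 1 (by norm_num), hsol _ h3, hsol (cubeRoot ^ 2) (by rw [← pow_mul, mul_comm, pow_mul,
      h3, one_pow])]
    have hw2 : cubeRoot ^ 2 = -cubeRoot - 1 := by linear_combination hw
    have hw4 : (cubeRoot ^ 2) ^ 2 = cubeRoot := by linear_combination cubeRoot * h3
    rw [hw4, hw2]
    generalize cubeRoot = w at *
    have e : (x - -(1 + 3 / 2 * (w * a + (-w - 1) * b))) *
        (x - -(1 + 3 / 2 * ((-w - 1) * a + w * b))) =
        (x + 1) ^ 2 - 3 / 2 * (x + 1) * (a + b) + 9 / 4 * (a ^ 2 - a * b + b ^ 2) := by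
      linear_combination (-9 / 4 * a ^ 2 - 9 / 4 * b ^ 2 + 9 / 2 * (a * b)) * hw
    rw [e]
    linear_combination (-27 / 8) * hab3 + 27 / 4 * (x + 1) * hab
  rw [hprod, Polynomial.roots_multiset_prod_X_sub_C]

/-! ### Triples and the ordering by modulus -/

theorem triple_eq_triple {α : Type*} {x y w a b c : α}
    (h : ({x, y, w} : Multiset α) = {a, b, c}) :
    x = a ∧ y = b ∧ w = c ∨ x = a ∧ y = c ∧ w = b ∨ x = b ∧ y = a ∧ w = c ∨
      x = b ∧ y = c ∧ w = a ∨ x = c ∧ y = a ∧ w = b ∨ x = c ∧ y = b ∧ w = a := by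
  classical
  simp [Multiset.cons_eq_cons] at h
  have hs := @Multiset.singleton_inj α
  grind

theorem exists_sorted_triple {α : Type*} (f : α → ℝ) (a b c : α) :
    ∃ x y w, ({x, y, w} : Multiset α) = {a, b, c} ∧ f x ≤ f y ∧ f y ≤ f w := by
  have h1 : ({b, a, c} : Multiset α) = {a, b, c} := Multiset.cons_swap ..
  have h2 : ∀ u v t : α, ({u, v, t} : Multiset α) = {u, t, v} := fun u v t =>
    congrArg (u ::ₘ ·) (Multiset.pair_comm v t)
  have h3 : ({c, a, b} : Multiset α) = {a, b, c} :=
    (Multiset.cons_swap ..).trans (h2 a c b)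
  rcases le_total (f a) (f b) with hab | hab <;> rcases le_total (f b) (f c) with hbc | hbc <;>
    rcases le_total (f a) (f c) with hac | hac
  · exact ⟨a, b, c, rfl, hab, hbc⟩
  · exact ⟨a, b, c, rfl, hab, hbc⟩
  · exact ⟨a, c, b, h2 .., hac, hbc⟩
  · exact ⟨c, a, b, h3, hac, hab⟩
  · exact ⟨b, a, c, h1, hab, hac⟩
  · exact ⟨b, c, a, (h2 ..).trans h1, hbc, hac⟩
  · exact ⟨c, b, a, (h2 ..).trans h3, hbc, hab⟩
  · exact ⟨c, b, a, (h2 ..).trans h3, hbc, hab⟩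

theorem exists_cubic_params (s : ℂ) : ∃ al be : ℂ, al ^ 3 = 1 + s ∧ be ^ 3 = 1 - s := by
  obtain ⟨al, h1⟩ := IsAlgClosed.exists_pow_nat_eq (1 + s) (n := 3) (by norm_num)
  obtain ⟨be, h2⟩ := IsAlgClosed.exists_pow_nat_eq (1 - s) (n := 3) (by norm_num)
  exact ⟨al, be, h1, h2⟩

theorem Icc_one_three_map (f : ℤ → ℂ) :
    (Finset.Icc (1 : ℤ) (((2 : ℕ) : ℤ) + (1 : ℕ))).val.map f = {f 1, f 2, f 3} := by
  have : (Finset.Icc (1 : ℤ) (((2 : ℕ) : ℤ) + (1 : ℕ))).val = {1, 2, 3} := by decide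
  rw [this]; rfl

theorem roots_of_params {lam s al be : ℂ} (hs : s ^ 2 = 1 - lam) (hal : al ^ 3 = 1 + s)
    (hbe : be ^ 3 = 1 - s) : (solutionPoly 2 1 cubicSymbol lam).roots =
      {cubicSol 1 al be, cubicSol cubeRoot al be, cubicSol (cubeRoot ^ 2) al be} :=
  roots_solutionPoly (by rw [hal, hbe]; ring) (by rw [hal, hbe]; linear_combination -hs)

theorem exists_isOrderedSolutions : ∃ z : ℤ → ℂ → ℂ, IsOrderedSolutions 2 1 cubicSymbol z := by
  have h : ∀ lam : ℂ, ∃ x y w : ℂ, ({x, y, w} : Multiset ℂ) =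
      (solutionPoly 2 1 cubicSymbol lam).roots ∧ ‖x‖ ≤ ‖y‖ ∧ ‖y‖ ≤ ‖w‖ := by
    intro lam
    obtain ⟨s, hs⟩ := IsAlgClosed.exists_pow_nat_eq (1 - lam) (n := 2) (by norm_num)
    obtain ⟨al, be, hal, hbe⟩ := exists_cubic_params s
    rw [roots_of_params hs hal hbe]
    exact exists_sorted_triple _ _ _ _
  choose x y w h hxy hyw using h
  refine ⟨fun j lam => if j = 1 then x lam else if j = 2 then y lam else w lam, fun lam => ⟨?_, ?_⟩⟩
  · rw [Icc_one_three_map, ← h]; norm_num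
  · intro i j hi hij hj
    push_cast at hj
    have := hxy lam
    have := hyw lam
    obtain rfl | rfl | rfl : i = 1 ∨ i = 2 ∨ i = 3 := by omega
    all_goals obtain rfl | rfl | rfl : j = 1 ∨ j = 2 ∨ j = 3 := by omega
    all_goals first | omega | (norm_num; try linarith)

theorem IsOrderedSolutions.triple {z : ℤ → ℂ → ℂ} (hz : IsOrderedSolutions 2 1 cubicSymbol z)
    {lam s al be : ℂ} (hs : s ^ 2 = 1 - lam) (hal : al ^ 3 = 1 + s) (hbe : be ^ 3 = 1 - s) :
    ({z 1 lam, z 2 lam, z 3 lam} : Multiset ℂ) =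
      {cubicSol 1 al be, cubicSol cubeRoot al be, cubicSol (cubeRoot ^ 2) al be} ∧
      ‖z 1 lam‖ ≤ ‖z 2 lam‖ ∧ ‖z 2 lam‖ ≤ ‖z 3 lam‖ := by
  refine ⟨?_, (hz lam).2 1 2 ?_ ?_ ?_, (hz lam).2 2 3 ?_ ?_ ?_⟩
  · rw [← roots_of_params hs hal hbe, ← (hz lam).1, Icc_one_three_map]
  all_goals norm_num

/-! ### Change of variables for densities -/

theorem measurableEmbedding_ofReal : MeasurableEmbedding (fun x : ℝ => (x : ℂ)) :=
  Complex.isometry_ofReal.isClosedEmbedding.measurableEmbedding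

theorem map_withDensity_of_measurable {s : Set ℝ} (hs : MeasurableSet s) {c c' : ℝ → ℝ}
    (hcm : Measurable c) (hc : ∀ t ∈ s, HasDerivWithinAt c (c' t) s t) (hinj : InjOn c s)
    {f h : ℝ → ℝ} (hh : ∀ t ∈ s, h t = f (c t) * |c' t|) :
    Measure.map c ((volume.restrict s).withDensity (fun t => ENNReal.ofReal (h t))) =
      (volume.restrict (c '' s)).withDensity (fun x => ENNReal.ofReal (f x)) := by
  ext A hA
  have hset : A ∩ c '' s = c '' (c ⁻¹' A ∩ s) := (image_preimage_inter c s A).symm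
  rw [Measure.map_apply hcm hA, withDensity_apply _ (hcm hA), withDensity_apply _ hA,
    Measure.restrict_restrict (hcm hA), Measure.restrict_restrict hA, hset,
    lintegral_image_eq_lintegral_abs_deriv_mul ((hcm hA).inter hs)
      (fun t ht => (hc t ht.2).mono inter_subset_right) (hinj.mono inter_subset_right)]
  refine setLIntegral_congr_fun ((hcm hA).inter hs) fun t ht => ?_
  simp only [hh t ht.2]
  rw [ENNReal.ofReal_mul' (abs_nonneg _), mul_comm]

/-- Change of variables: an injective differentiable `c` on `s` carries the density
`f (c t) |c' t|` to the density `f`. -/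
theorem map_withDensity_comp_mul_abs_deriv {s : Set ℝ} (hs : MeasurableSet s) {c c' : ℝ → ℝ}
    (hc : ∀ t ∈ s, HasDerivAt c (c' t) t) (hinj : InjOn c s)
    {f h : ℝ → ℝ} (hh : ∀ t ∈ s, h t = f (c t) * |c' t|) :
    Measure.map c ((volume.restrict s).withDensity (fun t => ENNReal.ofReal (h t))) =
      (volume.restrict (c '' s)).withDensity (fun x => ENNReal.ofReal (f x)) := by
  classical
  have hcont : ContinuousOn c s := fun t ht => (hc t ht).continuousAt.continuousWithinAt
  -- Nothing is known about `c` off `s`; replacing it there by `0` makes it measurable and changes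
  -- it only on a null set of the restricted measure.
  have heq : EqOn (s.piecewise c fun _ => 0) c s := piecewise_eqOn _ _ _
  have hae : c =ᵐ[(volume.restrict s).withDensity fun t => ENNReal.ofReal (h t)]
      s.piecewise c fun _ => 0 :=
    (withDensity_absolutelyContinuous _ _).ae_eq
      ((ae_restrict_iff' hs).2 (Eventually.of_forall fun t ht => (heq ht).symm))
  rw [Measure.map_congr hae, ← heq.image_eq]
  refine map_withDensity_of_measurable hs
    (hcont.measurable_piecewise continuous_const.continuousOn hs)
    (fun t ht => (hc t ht).hasDerivWithinAt.congr (fun x hx => heq hx) (heq ht))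
    (hinj.congr heq.symm) (fun t ht => ?_)
  rw [heq ht, hh t ht]

/-! ### One-sided limits along arcs in the real axis -/

/-- The open upper half plane. -/
def upperHalf : Set ℂ := {w | 0 < w.im}

/-- The open lower half plane. -/
def lowerHalf : Set ℂ := {w | w.im < 0}

theorem isOpen_upperHalf : IsOpen upperHalf := isOpen_lt continuous_const Complex.continuous_im

theorem isOpen_lowerHalf : IsOpen lowerHalf := isOpen_lt Complex.continuous_im continuous_const

theorem HasSideValues.mono {f : ℂ → ℂ} {l l' : Filter ℂ} {v v' : ℂ} (h : HasSideValues f l v v')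
    (hl : l' ≤ l) : HasSideValues f l' v v' :=
  ⟨hl h.1, h.2.1.mono_left hl, h.2.2.mono_left hl⟩

theorem HasSideValues.unique {f : ℂ → ℂ} {l : Filter ℂ} [l.NeBot] {v v' w w' : ℂ}
    (h : HasSideValues f l v v') (h' : HasSideValues f l w w') : v = w ∧ v' = w' :=
  ⟨tendsto_nhds_unique h.2.1 h'.2.1, tendsto_nhds_unique h.2.2 h'.2.2⟩

instance plusSide_neBot (γ : ℝ → ℂ) (t : ℝ) : (plusSide γ t).NeBot := by
  unfold plusSide; infer_instance

instance minusSide_neBot (γ : ℝ → ℂ) (t : ℝ) : (minusSide γ t).NeBot := by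
  unfold minusSide; infer_instance

/-- On a neighbourhood of `t`, the arc `γ` is real, equal to `c`, with derivative `c'`. -/
structure IsRealArcAt (γ : ℝ → ℂ) (c c' : ℝ → ℝ) (t : ℝ) : Prop where
  eq : ∀ᶠ u in 𝓝 t, γ u = c u
  deriv_eq : ∀ᶠ u in 𝓝 t, deriv γ u = c' u
  continuousAt : ContinuousAt c t
  continuousAt_deriv : ContinuousAt c' t

/-- Where `γ` and `γ'` are real, `γ u + i r γ' u` has imaginary part `r c' u`, so the signs of `r`
and `c'` decide which half plane is approached. -/
theorem IsRealArcAt.tendsto_side {γ : ℝ → ℂ} {c c' : ℝ → ℝ} {t : ℝ} (h : IsRealArcAt γ c c' t)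
    {l : Filter ℝ} (hl : l ≤ 𝓝 0) {s : Set ℂ}
    (hs : ∀ᶠ p in 𝓝 t ×ˢ l, ∀ w : ℂ, w.im = p.2 * c' p.1 → w ∈ s) :
    Filter.map (fun u : ℝ × ℝ => γ u.1 + Complex.I * (u.2 : ℂ) * deriv γ u.1) (𝓝 t ×ˢ l) ≤
      𝓝[s] (c t : ℂ) := by
  have hev : ∀ᶠ p in 𝓝 t ×ˢ l, (c p.1 : ℂ) + Complex.I * (p.2 : ℂ) * (c' p.1 : ℂ) =
      γ p.1 + Complex.I * (p.2 : ℂ) * deriv γ p.1 := by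
    filter_upwards [tendsto_fst.eventually h.eq, tendsto_fst.eventually h.deriv_eq] with p h1 h2
    rw [h1, h2]
  refine Tendsto.congr' hev (tendsto_nhdsWithin_iff.2 ⟨?_, ?_⟩)
  · have h1 : Tendsto (fun p : ℝ × ℝ => (c p.1 : ℂ)) (𝓝 t ×ˢ l) (𝓝 (c t : ℂ)) :=
      (Complex.continuous_ofReal.tendsto _).comp (h.continuousAt.tendsto.comp tendsto_fst)
    have h2 : Tendsto (fun p : ℝ × ℝ => (c' p.1 : ℂ)) (𝓝 t ×ˢ l) (𝓝 (c' t : ℂ)) :=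
      (Complex.continuous_ofReal.tendsto _).comp (h.continuousAt_deriv.tendsto.comp tendsto_fst)
    have h3 : Tendsto (fun p : ℝ × ℝ => (p.2 : ℂ)) (𝓝 t ×ˢ l) (𝓝 ((0 : ℝ) : ℂ)) :=
      (Complex.continuous_ofReal.tendsto _).comp (hl.trans' tendsto_snd)
    simpa using h1.add ((h3.const_mul Complex.I).mul h2)
  · filter_upwards [hs] with p hp
    exact hp _ (by simp)

/-- The jump `(1 / 2πi) ∑_{j=1}^{q+k} (z_j'₊ / z_j₊ - z_j'₋ / z_j₋)` across the real axis at `x`,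
oriented from left to right, is `v`. -/
def HasRealJump (q : ℕ) (z : ℤ → ℂ → ℂ) (k : ℤ) (x v : ℝ) : Prop :=
  ∃ vp vp' vm vm' : ℤ → ℂ,
    (∀ j ∈ Finset.Icc (1 : ℤ) ((q : ℤ) + k),
      HasSideValues (z j) (𝓝[upperHalf] (x : ℂ)) (vp j) (vp' j) ∧
      HasSideValues (z j) (𝓝[lowerHalf] (x : ℂ)) (vm j) (vm' j)) ∧
    (v : ℂ) = 1 / (2 * (Real.pi : ℂ) * Complex.I) *
      (∑ j ∈ Finset.Icc (1 : ℤ) ((q : ℤ) + k), (vp' j / vp j - vm' j / vm j))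

theorem IsArcDensity.unique {q : ℕ} {z : ℤ → ℂ → ℂ} {k : ℤ} {γ : ℝ → ℂ} {t h h' : ℝ}
    (H : IsArcDensity q z k γ t h) (H' : IsArcDensity q z k γ t h') : h = h' := by
  obtain ⟨vp, vp', vm, vm', h1, h2⟩ := H
  obtain ⟨wp, wp', wm, wm', h3, h4⟩ := H'
  have : (h : ℂ) = h' := by
    rw [h2, h4]
    congr 2
    refine Finset.sum_congr rfl fun j hj => ?_
    obtain ⟨e1, e2⟩ := (h1 j hj).1.unique (h3 j hj).1
    obtain ⟨e3, e4⟩ := (h1 j hj).2.unique (h3 j hj).2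
    rw [e1, e2, e3, e4]
  exact_mod_cast this

/-- Independence of orientation: if `c' < 0`, the left side of the arc is the lower half plane, so
the jump changes sign together with `dλ`. Hence the factor `|c'|`. -/
theorem HasRealJump.isArcDensity {q : ℕ} {z : ℤ → ℂ → ℂ} {k : ℤ} {γ : ℝ → ℂ} {c c' : ℝ → ℝ}
    {t v : ℝ} (hv : HasRealJump q z k (c t) v) (hγ : IsRealArcAt γ c c' t) (hc' : c' t ≠ 0) :
    IsArcDensity q z k γ t (v * |c' t|) := by
  obtain ⟨vp, vp', vm, vm', h1, h2⟩ := hv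
  have hd : deriv γ t = c' t := hγ.deriv_eq.self_of_nhds
  have hr : ∀ᶠ p : ℝ × ℝ in 𝓝 t ×ˢ 𝓝[>] (0 : ℝ), 0 < p.2 :=
    tendsto_snd.eventually self_mem_nhdsWithin
  have hl : ∀ᶠ p : ℝ × ℝ in 𝓝 t ×ˢ 𝓝[<] (0 : ℝ), p.2 < 0 :=
    tendsto_snd.eventually self_mem_nhdsWithin
  rcases hc'.lt_or_gt with hneg | hpos
  · have hn := hγ.continuousAt_deriv.eventually_lt continuousAt_const hneg
    have hp : plusSide γ t ≤ 𝓝[lowerHalf] (c t : ℂ) := by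
      refine hγ.tendsto_side nhdsWithin_le_nhds ?_
      filter_upwards [hr, tendsto_fst.eventually hn] with p hp1 hp2 w hw
      exact (hw.trans_lt (mul_neg_of_pos_of_neg hp1 hp2) : w.im < 0)
    have hm : minusSide γ t ≤ 𝓝[upperHalf] (c t : ℂ) := by
      refine hγ.tendsto_side nhdsWithin_le_nhds ?_
      filter_upwards [hl, tendsto_fst.eventually hn] with p hp1 hp2 w hw
      exact (hw.symm ▸ mul_pos_of_neg_of_neg hp1 hp2 : 0 < w.im)
    refine ⟨vm, vm', vp, vp', fun j hj => ⟨(h1 j hj).2.mono hp, (h1 j hj).1.mono hm⟩, ?_⟩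
    rw [hd, abs_of_neg hneg, Complex.ofReal_mul, h2, Complex.ofReal_neg]
    simp only [Finset.sum_sub_distrib]
    ring
  · have hn := continuousAt_const.eventually_lt hγ.continuousAt_deriv hpos
    have hp : plusSide γ t ≤ 𝓝[upperHalf] (c t : ℂ) := by
      refine hγ.tendsto_side nhdsWithin_le_nhds ?_
      filter_upwards [hr, tendsto_fst.eventually hn] with p hp1 hp2 w hw
      exact (hw.symm ▸ mul_pos hp1 hp2 : 0 < w.im)
    have hm : minusSide γ t ≤ 𝓝[lowerHalf] (c t : ℂ) := by
      refine hγ.tendsto_side nhdsWithin_le_nhds ?_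
      filter_upwards [hl, tendsto_fst.eventually hn] with p hp1 hp2 w hw
      exact (hw.trans_lt (mul_neg_of_neg_of_pos hp1 hp2) : w.im < 0)
    refine ⟨vp, vp', vm, vm', fun j hj => ⟨(h1 j hj).1.mono hp, (h1 j hj).2.mono hm⟩, ?_⟩
    rw [hd, abs_of_pos hpos, Complex.ofReal_mul, h2]

/-- A real analytic arc, seen as a real function. -/
theorem IsAnalyticArc.exists_real {γ : ℝ → ℂ} (hγ : IsAnalyticArc γ) {S : Set ℝ}
    (hS : γ '' Ioo 0 1 ⊆ (fun x : ℝ => (x : ℂ)) '' S) :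
    ∃ c c' : ℝ → ℝ, (∀ t ∈ Ioo (0 : ℝ) 1, γ t = c t ∧ HasDerivAt c (c' t) t ∧ c' t ≠ 0 ∧
      IsRealArcAt γ c c' t ∧ c t ∈ interior S) ∧ InjOn c (Ioo 0 1) := by
  have hcS : ∀ t ∈ Ioo (0 : ℝ) 1, γ t = ((γ t).re : ℂ) ∧ (γ t).re ∈ S := by
    intro t ht
    obtain ⟨x, hx, hxt⟩ := hS (mem_image_of_mem γ ht)
    simp only at hxt
    rw [← hxt]
    exact ⟨by simp, by simpa using hx⟩
  have hnhds : ∀ t ∈ Ioo (0 : ℝ) 1, Ioo (0 : ℝ) 1 ∈ 𝓝 t := fun t ht => Ioo_mem_nhds ht.1 ht.2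
  have hder : ∀ t ∈ Ioo (0 : ℝ) 1, HasDerivAt γ (deriv γ t) t := fun t ht =>
    (hγ.analytic t ht).differentiableAt.hasDerivAt
  have hre : ∀ t ∈ Ioo (0 : ℝ) 1, HasDerivAt (fun u => (γ u).re) (deriv γ t).re t := fun t ht =>
    Complex.reCLM.hasFDerivAt.comp_hasDerivAt t (hder t ht)
  have hdre : ∀ t ∈ Ioo (0 : ℝ) 1, deriv γ t = ((deriv γ t).re : ℂ) := by
    intro t ht
    have h1 : HasDerivAt (fun u => ((γ u).re : ℂ)) ((deriv γ t).re : ℂ) t := (hre t ht).ofReal_comp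
    refine (h1.congr_of_eventuallyEq ?_).deriv
    filter_upwards [hnhds t ht] with u hu using (hcS u hu).1
  have hne : ∀ t ∈ Ioo (0 : ℝ) 1, (deriv γ t).re ≠ 0 := by
    intro t ht h0
    apply hγ.deriv_ne_zero t ht
    rw [hdre t ht, h0, Complex.ofReal_zero]
  have hcd : ∀ t ∈ Ioo (0 : ℝ) 1, ContinuousAt (fun u => (deriv γ u).re) t := fun t ht =>
    Complex.continuous_re.continuousAt.comp (hγ.analytic t ht).deriv.continuousAt
  refine ⟨fun t => (γ t).re, fun t => (deriv γ t).re, fun t ht => ⟨(hcS t ht).1, hre t ht, hne t ht,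
    ⟨?_, ?_, (hre t ht).continuousAt, hcd t ht⟩, ?_⟩, ?_⟩
  · filter_upwards [hnhds t ht] with u hu using (hcS u hu).1
  · filter_upwards [hnhds t ht] with u hu using hdre u hu
  -- A nonzero strict derivative makes the map open at `t`, so an arc contained in `S` avoids the
  -- boundary points of `S`.
  · have hstrict : HasStrictDerivAt (fun u => (γ u).re) (deriv γ t).re t :=
      hasStrictDerivAt_of_hasDerivAt_of_continuousAt
        (by filter_upwards [hnhds t ht] with u hu using hre u hu) (hcd t ht)
    rw [mem_interior_iff_mem_nhds, ← hstrict.map_nhds_eq (hne t ht), mem_map]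
    filter_upwards [hnhds t ht] with u hu using (hcS u hu).2
  · intro t ht u hu htu
    have : γ t = γ u := by rw [(hcS t ht).1, (hcS u hu).1]; exact congrArg _ htu
    exact congrArg Subtype.val (hγ.embedding.injective (a₁ := ⟨t, ht⟩) (a₂ := ⟨u, hu⟩) this)

/-! ### The measure is determined by the real jump -/

/-- Uniqueness of one-sided limits forces the density on each arc to be `f (c t) |c' t|`, which
pushes forward to `f` on the image of the arc. The images are disjoint and fill `S` up to a finite,
hence null, set. -/
theorem IsMu.eq_realDensityMeasure {q : ℕ} {z : ℤ → ℂ → ℂ} {k : ℤ} {S : Set ℝ} {f : ℝ → ℝ}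
    (hG : Gam q z k = (fun x : ℝ => (x : ℂ)) '' S)
    (hjump : ∀ x ∈ interior S, HasRealJump q z k x (f x))
    {μ : Measure ℂ} (hμ : IsMu q z k μ) : μ = realDensityMeasure S f := by
  obtain ⟨E, m, γ, h, hE, harc, hdE, hdis, hGE, hdens, rfl⟩ := hμ
  have hsub : ∀ i, γ i '' Ioo 0 1 ⊆ (fun x : ℝ => (x : ℂ)) '' S := by
    intro i
    rw [← hG, hGE]
    exact (subset_iUnion (fun i => γ i '' Ioo 0 1) i).trans subset_union_right
  choose c c' hc hinj using fun i => (harc i).exists_real (hsub i)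
  have himg : ∀ i, γ i '' Ioo 0 1 = (fun x : ℝ => (x : ℂ)) '' (c i '' Ioo 0 1) := by
    intro i
    rw [image_image]
    exact image_congr fun t ht => (hc i t ht).1
  have hci : ∀ i, ContinuousOn (c i) (Ioo 0 1) := fun i t ht =>
    (hc i t ht).2.1.continuousAt.continuousWithinAt
  have hmeas : ∀ i, MeasurableSet (c i '' Ioo 0 1) := fun i =>
    measurableSet_Ioo.image_of_continuousOn_injOn (hci i) (hinj i)
  have hdc : Pairwise (Function.onFun Disjoint fun i => c i '' Ioo (0 : ℝ) 1) := by
    intro i j hij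
    have := hdis i j hij
    rw [himg i, himg j] at this
    exact (disjoint_image_iff Complex.ofReal_injective).1 this
  have hh : ∀ i, ∀ t ∈ Ioo (0 : ℝ) 1, h i t = f (c i t) * |c' i t| := by
    intro i t ht
    obtain ⟨-, -, hne, hreal, hint⟩ := hc i t ht
    exact (hdens i t ht).2.unique ((hjump _ hint).isArcDensity hreal hne)
  have hpiece : ∀ i, Measure.map (γ i)
      ((volume.restrict (Ioo (0 : ℝ) 1)).withDensity (fun t => ENNReal.ofReal (h i t))) =
      Measure.map (fun x : ℝ => (x : ℂ)) ((volume.restrict (c i '' Ioo 0 1)).withDensity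
        (fun x => ENNReal.ofReal (f x))) := by
    intro i
    have hae : γ i =ᵐ[(volume.restrict (Ioo (0 : ℝ) 1)).withDensity
        (fun t => ENNReal.ofReal (h i t))] (fun x : ℝ => (x : ℂ)) ∘ c i :=
      (withDensity_absolutelyContinuous _ _).ae_eq
        ((ae_restrict_iff' measurableSet_Ioo).2 (Eventually.of_forall fun t ht => (hc i t ht).1))
    rw [Measure.map_congr hae, ← AEMeasurable.map_map_of_aemeasurable
      measurableEmbedding_ofReal.measurable.aemeasurable
      (((hci i).aemeasurable measurableSet_Ioo).mono_ac (withDensity_absolutelyContinuous _ _)),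
      map_withDensity_comp_mul_abs_deriv measurableSet_Ioo (fun t ht => (hc i t ht).2.1) (hinj i)
        (hh i)]
  have hSe : S =ᵐ[volume] ⋃ i, c i '' Ioo 0 1 := by
    have hfin : ((fun x : ℝ => (x : ℂ)) ⁻¹' E).Finite :=
      hE.preimage Complex.ofReal_injective.injOn
    have hSU : S = (fun x : ℝ => (x : ℂ)) ⁻¹' E ∪ ⋃ i, c i '' Ioo 0 1 := by
      have h1 : (fun x : ℝ => (x : ℂ)) ⁻¹' Gam q z k = S := by
        rw [hG]; exact preimage_image_eq _ Complex.ofReal_injective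
      rw [← h1, hGE, preimage_union, preimage_iUnion]
      congr 1
      refine iUnion_congr fun i => ?_
      rw [himg i]; exact preimage_image_eq _ Complex.ofReal_injective
    rw [hSU]
    exact union_ae_eq_right_of_ae_eq_empty (ae_eq_empty.2 (hfin.measure_zero _))
  unfold realDensityMeasure
  rw [Measure.restrict_congr_set hSe, Measure.restrict_iUnion hdc hmeas, withDensity_sum,
    Measure.map_sum measurableEmbedding_ofReal.measurable.aemeasurable, Measure.sum_fintype]
  exact Finset.sum_congr rfl fun i _ => hpiece i

theorem isMu_iff_eq_realDensityMeasure {q : ℕ} {z : ℤ → ℂ → ℂ} {k : ℤ} {S : Set ℝ} {f : ℝ → ℝ}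
    (hG : Gam q z k = (fun x : ℝ => (x : ℂ)) '' S)
    (hjump : ∀ x ∈ interior S, HasRealJump q z k x (f x)) (hf : ∀ x ∈ interior S, 0 ≤ f x)
    (hfin : (S \ interior S).Finite) {γ : ℝ → ℂ} (hγ : IsAnalyticArc γ)
    (hγS : γ '' Ioo 0 1 = (fun x : ℝ => (x : ℂ)) '' interior S) (μ : Measure ℂ) :
    IsMu q z k μ ↔ μ = realDensityMeasure S f := by
  refine ⟨fun h => h.eq_realDensityMeasure hG hjump, ?_⟩
  obtain ⟨c, c', hc, -⟩ := hγ.exists_real (hγS.subset.trans (image_mono interior_subset))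
  have hMu : IsMu q z k (∑ _i : Fin 1, Measure.map γ ((volume.restrict (Ioo (0 : ℝ) 1)).withDensity
      (fun t => ENNReal.ofReal (f (c t) * |c' t|)))) := by
    refine ⟨(fun x : ℝ => (x : ℂ)) '' (S \ interior S), 1, fun _ => γ,
      fun _ t => f (c t) * |c' t|, hfin.image _, fun _ => hγ, fun _ => ?_, fun i j hij => ?_, ?_,
      fun _ t ht => ?_, rfl⟩
    · rw [hγS, disjoint_image_iff Complex.ofReal_injective]
      exact disjoint_sdiff_left
    · exact absurd (Subsingleton.elim i j) hij
    · rw [iUnion_const, hγS, ← image_union, sdiff_union_of_subset interior_subset, hG]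
    · obtain ⟨-, -, hne, hreal, hint⟩ := hc t ht
      exact ⟨mul_nonneg (hf _ hint) (abs_nonneg _), (hjump _ hint).isArcDensity hreal hne⟩
  -- Existence follows from uniqueness: the measure built from the single arc `γ` satisfies `IsMu`,
  -- so it must be the one with density `f`.
  rintro rfl
  rw [← hMu.eq_realDensityMeasure hG hjump]
  exact hMu

/-! ### Comparison of moduli -/

theorem normSq_add_mul (w al be : ℂ) : Complex.normSq (al + w * be) = Complex.normSq al +
    Complex.normSq w * Complex.normSq be + 2 * ((al * star be) * star w).re := by
  simp only [Complex.normSq_apply, Complex.add_re, Complex.add_im, Complex.mul_re, Complex.mul_im,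
    Complex.star_def, Complex.conj_re, Complex.conj_im]
  ring

theorem norm_cubicSol_lt_iff {w v al be : ℂ} (hw : Complex.normSq w = 1)
    (hv : Complex.normSq v = 1) : ‖cubicSol w al be‖ < ‖cubicSol v al be‖ ↔
      ((al * star be) * star w).re < ((al * star be) * star v).re := by
  have h : ∀ u : ℂ, ‖cubicSol u al be‖ = 1 / 2 * ‖al + u * be‖ ^ 3 := by
    intro u; unfold cubicSol; rw [norm_mul, norm_pow]; norm_num
  rw [h, h, mul_lt_mul_iff_right₀ (by norm_num),
    pow_lt_pow_iff_left₀ (norm_nonneg _) (norm_nonneg _) (by norm_num),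
    ← pow_lt_pow_iff_left₀ (norm_nonneg _) (norm_nonneg _) (two_ne_zero), ← Complex.normSq_eq_norm_sq,
    ← Complex.normSq_eq_norm_sq, normSq_add_mul, normSq_add_mul, hw, hv]
  constructor <;> intro h <;> linarith

theorem cubeRoot_sq : cubeRoot ^ 2 = ⟨-1 / 2, -(Real.sqrt 3 / 2)⟩ := by
  have h : cubeRoot ^ 2 = -cubeRoot - 1 := by linear_combination cubeRoot_sq_add
  rw [h]
  apply Complex.ext
  · simp [cubeRoot_re]; norm_num
  · simp [cubeRoot_im]

theorem normSq_cubeRoot : Complex.normSq cubeRoot = 1 := by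
  have h := Real.mul_self_sqrt (show (0 : ℝ) ≤ 3 by norm_num)
  rw [Complex.normSq_apply, cubeRoot_re, cubeRoot_im]
  linarith

theorem normSq_cubeRoot_sq : Complex.normSq (cubeRoot ^ 2) = 1 := by
  rw [map_pow, normSq_cubeRoot, one_pow]

theorem re_mul_star_one (P : ℂ) : (P * star 1).re = P.re := by simp

theorem re_mul_star_cubeRoot (P : ℂ) :
    (P * star cubeRoot).re = -P.re / 2 + Real.sqrt 3 / 2 * P.im := by
  simp only [Complex.mul_re, Complex.star_def, Complex.conj_re, Complex.conj_im, cubeRoot_re,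
    cubeRoot_im]
  ring

theorem re_mul_star_cubeRoot_sq (P : ℂ) :
    (P * star (cubeRoot ^ 2)).re = -P.re / 2 - Real.sqrt 3 / 2 * P.im := by
  simp only [cubeRoot_sq, Complex.mul_re, Complex.star_def, Complex.conj_re, Complex.conj_im]
  ring

theorem norm_cubicSol_one_lt_two {al be : ℂ} :
    ‖cubicSol cubeRoot al be‖ < ‖cubicSol (cubeRoot ^ 2) al be‖ ↔
      Real.sqrt 3 * (al * star be).im < 0 := by
  rw [norm_cubicSol_lt_iff normSq_cubeRoot normSq_cubeRoot_sq, re_mul_star_cubeRoot,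
    re_mul_star_cubeRoot_sq]
  constructor <;> intro h <;> linarith

theorem norm_cubicSol_two_lt_one {al be : ℂ} :
    ‖cubicSol (cubeRoot ^ 2) al be‖ < ‖cubicSol cubeRoot al be‖ ↔
      0 < Real.sqrt 3 * (al * star be).im := by
  rw [norm_cubicSol_lt_iff normSq_cubeRoot_sq normSq_cubeRoot, re_mul_star_cubeRoot,
    re_mul_star_cubeRoot_sq]
  constructor <;> intro h <;> linarith

theorem norm_cubicSol_one_lt_zero {al be : ℂ} :
    ‖cubicSol cubeRoot al be‖ < ‖cubicSol 1 al be‖ ↔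
      Real.sqrt 3 * (al * star be).im < 3 * (al * star be).re := by
  rw [norm_cubicSol_lt_iff normSq_cubeRoot (map_one _), re_mul_star_cubeRoot, re_mul_star_one]
  constructor <;> intro h <;> linarith

theorem norm_cubicSol_zero_lt_one {al be : ℂ} :
    ‖cubicSol 1 al be‖ < ‖cubicSol cubeRoot al be‖ ↔
      3 * (al * star be).re < Real.sqrt 3 * (al * star be).im := by
  rw [norm_cubicSol_lt_iff (map_one _) normSq_cubeRoot, re_mul_star_cubeRoot, re_mul_star_one]
  constructor <;> intro h <;> linarith

theorem norm_cubicSol_two_lt_zero {al be : ℂ} :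
    ‖cubicSol (cubeRoot ^ 2) al be‖ < ‖cubicSol 1 al be‖ ↔
      -(Real.sqrt 3 * (al * star be).im) < 3 * (al * star be).re := by
  rw [norm_cubicSol_lt_iff normSq_cubeRoot_sq (map_one _), re_mul_star_cubeRoot_sq,
    re_mul_star_one]
  constructor <;> intro h <;> linarith

theorem norm_cubicSol_zero_lt_two {al be : ℂ} :
    ‖cubicSol 1 al be‖ < ‖cubicSol (cubeRoot ^ 2) al be‖ ↔
      3 * (al * star be).re < -(Real.sqrt 3 * (al * star be).im) := by
  rw [norm_cubicSol_lt_iff (map_one _) normSq_cubeRoot_sq, re_mul_star_cubeRoot_sq,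
    re_mul_star_one]
  constructor <;> intro h <;> linarith

/-- The imaginary part of `(α conj β)³ = (1 + s) conj (1 - s)` is `2 Im s`. -/
theorem im_mul_star_mul {s al be : ℂ} (hal : al ^ 3 = 1 + s) (hbe : be ^ 3 = 1 - s) :
    (al * star be).im * (3 * (al * star be).re ^ 2 - (al * star be).im ^ 2) = 2 * s.im := by
  have h : (al * star be) ^ 3 = (1 + s) * star (1 - s) := by
    rw [mul_pow, hal, ← hbe, star_pow]
  have h2 := congrArg Complex.im h
  generalize al * star be = P at h2 ⊢
  have h3 : (P ^ 3).im = P.im * (3 * P.re ^ 2 - P.im ^ 2) := by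
    rw [pow_succ, pow_two]; simp only [Complex.mul_im, Complex.mul_re]; ring
  rw [← h3, h2]
  simp
  ring

/-- An equality of moduli means `Im P = 0` or `3 Re P = ±√3 Im P` for `P = α β̄`; either way the
left side of `im_mul_star_mul` vanishes, against `Im s ≠ 0`. -/
theorem norm_cubicSol_pairwise_ne {s al be : ℂ} (hal : al ^ 3 = 1 + s) (hbe : be ^ 3 = 1 - s)
    (hs : s.im ≠ 0) : ‖cubicSol 1 al be‖ ≠ ‖cubicSol cubeRoot al be‖ ∧
      ‖cubicSol 1 al be‖ ≠ ‖cubicSol (cubeRoot ^ 2) al be‖ ∧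
      ‖cubicSol cubeRoot al be‖ ≠ ‖cubicSol (cubeRoot ^ 2) al be‖ := by
  have key := im_mul_star_mul hal hbe
  have h3 := Real.mul_self_sqrt (show (0 : ℝ) ≤ 3 by norm_num)
  have e10 := norm_cubicSol_one_lt_zero (al := al) (be := be)
  have e01 := norm_cubicSol_zero_lt_one (al := al) (be := be)
  have e20 := norm_cubicSol_two_lt_zero (al := al) (be := be)
  have e02 := norm_cubicSol_zero_lt_two (al := al) (be := be)
  have e12 := norm_cubicSol_one_lt_two (al := al) (be := be)
  have e21 := norm_cubicSol_two_lt_one (al := al) (be := be)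
  generalize al * star be = P at *
  -- The sign `e = ±1` covers both slanted lines; squaring gives `3 (Re P)² = (Im P)²`.
  have hfac : ∀ e : ℝ, e ^ 2 = 1 → 3 * P.re = e * (Real.sqrt 3 * P.im) → False := by
    intro e he h
    apply hs
    have h4 : (3 * P.re) ^ 2 = 3 * P.im ^ 2 := by
      rw [h]; linear_combination (Real.sqrt 3 * P.im) ^ 2 * he + P.im ^ 2 * h3
    have h5 : 3 * P.re ^ 2 - P.im ^ 2 = 0 := by linarith
    rw [h5] at key; linarith
  refine ⟨fun h => ?_, fun h => ?_, fun h => ?_⟩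
  · have h1 := mt e10.2 h.not_gt
    have h2 := mt e01.2 h.not_lt
    exact hfac 1 (by norm_num) (by linarith)
  · have h1 := mt e20.2 h.not_gt
    have h2 := mt e02.2 h.not_lt
    exact hfac (-1) (by norm_num) (by linarith)
  · have h1 := mt e12.2 h.not_lt
    have h2 := mt e21.2 h.not_gt
    have : P.im = 0 :=
      (mul_eq_zero.1 (le_antisymm (not_lt.1 h2) (not_lt.1 h1))).resolve_left (by positivity)
    apply hs
    rw [this] at key; linarith

/-! ### Real parameters and the sets `Γ_k` -/

/-- The real cube root of `1 + √(1 - x)`. -/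
noncomputable def realAlpha (x : ℝ) : ℝ := (1 + Real.sqrt (1 - x)) ^ (1 / 3 : ℝ)

/-- The real cube root of `1 - √(1 - x)`. -/
noncomputable def realBeta (x : ℝ) : ℝ :=
  if 0 ≤ x then (1 - Real.sqrt (1 - x)) ^ (1 / 3 : ℝ) else -(Real.sqrt (1 - x) - 1) ^ (1 / 3 : ℝ)

theorem rpow_third_pow {r : ℝ} (hr : 0 ≤ r) : (r ^ (1 / 3 : ℝ)) ^ 3 = r := by
  rw [← Real.rpow_natCast, ← Real.rpow_mul hr]; norm_num

theorem realAlpha_pow (x : ℝ) : realAlpha x ^ 3 = 1 + Real.sqrt (1 - x) :=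
  rpow_third_pow (by positivity)

theorem realBeta_pow (x : ℝ) : realBeta x ^ 3 = 1 - Real.sqrt (1 - x) := by
  unfold realBeta
  split_ifs with h
  · refine rpow_third_pow ?_
    rw [sub_nonneg, Real.sqrt_le_one]; linarith
  · rw [Odd.neg_pow (by decide), rpow_third_pow]; · ring
    rw [sub_nonneg, Real.one_le_sqrt]; linarith

theorem realAlpha_mul_realBeta_pow {x : ℝ} (hx : x ≤ 1) : (realAlpha x * realBeta x) ^ 3 = x := by
  rw [mul_pow, realAlpha_pow, realBeta_pow]
  linear_combination -Real.sq_sqrt (sub_nonneg.2 hx)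

theorem realAlpha_mul_realBeta_pos {x : ℝ} (hx : x ≤ 1) :
    0 < realAlpha x * realBeta x ↔ 0 < x := by
  rw [← Odd.pow_pos_iff (n := 3) (by decide), realAlpha_mul_realBeta_pow hx]

theorem realAlpha_mul_realBeta_neg {x : ℝ} (hx : x ≤ 1) :
    realAlpha x * realBeta x < 0 ↔ x < 0 := by
  rw [← Odd.pow_neg_iff (n := 3) (by decide), realAlpha_mul_realBeta_pow hx]

theorem ofReal_params {x : ℝ} (hx : x ≤ 1) : ((Real.sqrt (1 - x) : ℝ) : ℂ) ^ 2 = 1 - (x : ℂ) ∧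
    (realAlpha x : ℂ) ^ 3 = 1 + (Real.sqrt (1 - x) : ℝ) ∧
    (realBeta x : ℂ) ^ 3 = 1 - (Real.sqrt (1 - x) : ℝ) := by
  refine ⟨?_, ?_, ?_⟩
  · exact_mod_cast Real.sq_sqrt (sub_nonneg.2 hx)
  · exact_mod_cast realAlpha_pow x
  · exact_mod_cast realBeta_pow x

/-- Here `P = αβ` is real, so the two nonreal `w` give equal moduli. The modulus for `w = 1` is
larger when `x > 0`, smaller when `x < 0`, and equal to them at `x = 0`. -/
theorem IsOrderedSolutions.norm_eq_of_real {z : ℤ → ℂ → ℂ}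
    (hz : IsOrderedSolutions 2 1 cubicSymbol z) {x : ℝ} (hx : x ≤ 1) :
    (‖z 1 x‖ = ‖z 2 x‖ ↔ 0 ≤ x) ∧ (‖z 2 x‖ = ‖z 3 x‖ ↔ x ≤ 0) := by
  obtain ⟨h1, h2, h3⟩ := ofReal_params hx
  obtain ⟨hm, h12, h23⟩ := hz.triple h1 h2 h3
  have hP : (realAlpha x : ℂ) * star (realBeta x : ℂ) = ((realAlpha x * realBeta x : ℝ) : ℂ) := by
    simp
  have e01 := norm_cubicSol_one_lt_zero (al := realAlpha x) (be := realBeta x)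
  have e10 := norm_cubicSol_zero_lt_one (al := realAlpha x) (be := realBeta x)
  have e12 := norm_cubicSol_one_lt_two (al := realAlpha x) (be := realBeta x)
  have e21 := norm_cubicSol_two_lt_one (al := realAlpha x) (be := realBeta x)
  rw [hP, Complex.ofReal_im, Complex.ofReal_re, mul_zero] at e01 e10
  rw [hP, Complex.ofReal_im, mul_zero] at e12 e21
  simp only [lt_self_iff_false, iff_false, not_lt] at e12 e21
  have hpos := realAlpha_mul_realBeta_pos hx
  have hneg := realAlpha_mul_realBeta_neg hx
  have e01' : ‖cubicSol cubeRoot (realAlpha x) (realBeta x)‖ <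
      ‖cubicSol 1 (realAlpha x) (realBeta x)‖ ↔ 0 < x := by
    rw [e01, ← hpos]; constructor <;> intro h <;> linarith
  have e10' : ‖cubicSol 1 (realAlpha x) (realBeta x)‖ <
      ‖cubicSol cubeRoot (realAlpha x) (realBeta x)‖ ↔ x < 0 := by
    rw [e10, ← hneg]; constructor <;> intro h <;> linarith
  rw [← not_lt, ← e10', ← not_lt, ← e01']
  clear e01 e10 e01' e10' hP hpos hneg h1 h2 h3
  rcases triple_eq_triple hm with h | h | h | h | h | h <;> obtain ⟨h1, h2, h3⟩ := h <;>
    rw [h1, h2] at h12 ⊢ <;> rw [h2, h3] at h23 <;> rw [h3] <;>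
    constructor <;> constructor <;> intro h <;>
    first
    | (intro h'; linarith)
    | (rw [not_lt] at h; linarith)

theorem IsOrderedSolutions.real_of_norm_eq {z : ℤ → ℂ → ℂ}
    (hz : IsOrderedSolutions 2 1 cubicSymbol z) {lam : ℂ}
    (h : ‖z 1 lam‖ = ‖z 2 lam‖ ∨ ‖z 2 lam‖ = ‖z 3 lam‖) : ∃ x : ℝ, x ≤ 1 ∧ (x : ℂ) = lam := by
  obtain ⟨s, hs⟩ := IsAlgClosed.exists_pow_nat_eq (1 - lam) (n := 2) (by norm_num)
  obtain ⟨al, be, hal, hbe⟩ := exists_cubic_params s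
  obtain ⟨hm, -⟩ := hz.triple hs hal hbe
  have him : s.im = 0 := by
    by_contra hne
    obtain ⟨n01, n02, n12⟩ := norm_cubicSol_pairwise_ne hal hbe hne
    rcases triple_eq_triple hm with h' | h' | h' | h' | h' | h' <;> obtain ⟨h1, h2, h3⟩ := h' <;>
      rw [h1, h2, h3] at h <;> rcases h with h | h <;>
      first
      | exact n01 h
      | exact n02 h
      | exact n12 h
      | exact n01 h.symm
      | exact n02 h.symm
      | exact n12 h.symm
  refine ⟨1 - s.re ^ 2, by nlinarith [sq_nonneg s.re], ?_⟩
  have hsr : s = (s.re : ℂ) := Complex.ext rfl (by simp [him])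
  rw [hsr] at hs
  push_cast
  linear_combination -hs

theorem IsOrderedSolutions.gam_zero {z : ℤ → ℂ → ℂ} (hz : IsOrderedSolutions 2 1 cubicSymbol z) :
    Gam 1 z 0 = (fun x : ℝ => (x : ℂ)) '' Icc 0 1 := by
  ext lam
  have : lam ∈ Gam 1 z 0 ↔ ‖z 1 lam‖ = ‖z 2 lam‖ := by
    simp only [Gam, mem_ofPred_eq]; norm_num
  rw [this]
  constructor
  · intro h
    obtain ⟨x, hx, rfl⟩ := hz.real_of_norm_eq (Or.inl h)
    exact ⟨x, ⟨(hz.norm_eq_of_real hx).1.1 h, hx⟩, rfl⟩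
  · rintro ⟨x, hx, rfl⟩
    exact (hz.norm_eq_of_real hx.2).1.2 hx.1

theorem IsOrderedSolutions.gam_one {z : ℤ → ℂ → ℂ} (hz : IsOrderedSolutions 2 1 cubicSymbol z) :
    Gam 1 z 1 = (fun x : ℝ => (x : ℂ)) '' Iic 0 := by
  ext lam
  have : lam ∈ Gam 1 z 1 ↔ ‖z 2 lam‖ = ‖z 3 lam‖ := by
    simp only [Gam, mem_ofPred_eq]; norm_num
  rw [this]
  constructor
  · intro h
    obtain ⟨x, hx, rfl⟩ := hz.real_of_norm_eq (Or.inr h)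
    exact ⟨x, (hz.norm_eq_of_real hx).2.1 h, rfl⟩
  · rintro ⟨x, hx, rfl⟩
    exact (hz.norm_eq_of_real (le_trans hx zero_le_one)).2.2 hx

/-! ### Holomorphic branches near the real axis -/

theorem cpow_third_pow (x : ℂ) : (x ^ (3 : ℂ)⁻¹) ^ 3 = x := by
  simp

theorem cpow_half_pow (x : ℂ) : (x ^ (2 : ℂ)⁻¹) ^ 2 = x := by
  simp

theorem ofReal_cpow_third {r : ℝ} (hr : 0 ≤ r) :
    (r : ℂ) ^ (3 : ℂ)⁻¹ = ((r ^ (1 / 3 : ℝ) : ℝ) : ℂ) := by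
  rw [Complex.ofReal_cpow hr]; norm_num

/-- Holomorphic parameters `s, α, β` near the real point `x`, extending the real ones. -/
structure IsBranchAt (s al be : ℂ → ℂ) (x : ℝ) : Prop where
  sq : ∀ lam, s lam ^ 2 = 1 - lam
  al_pow : ∀ lam, al lam ^ 3 = 1 + s lam
  be_pow : ∀ lam, be lam ^ 3 = 1 - s lam
  analytic_s : AnalyticAt ℂ s x
  analytic_al : AnalyticAt ℂ al x
  analytic_be : AnalyticAt ℂ be x
  s_eq : s x = (Real.sqrt (1 - x) : ℝ)
  al_eq : al x = (realAlpha x : ℝ)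
  be_eq : be x = (realBeta x : ℝ)

/-- Principal powers suffice, except that for `x < 0` the value `1 - s` is negative and lies on the
branch cut; there `β = -(s - 1)^(1/3)` is used. -/
theorem exists_isBranchAt {x : ℝ} (hx1 : x < 1) (hx0 : x ≠ 0) :
    ∃ s al be : ℂ → ℂ, IsBranchAt s al be x := by
  have hs0 : 0 < 1 - x := sub_pos.2 hx1
  set s : ℂ → ℂ := fun lam => (1 - lam) ^ (2 : ℂ)⁻¹ with hs
  have hs_eq : s x = (Real.sqrt (1 - x) : ℝ) := by
    rw [Real.sqrt_eq_rpow, Complex.ofReal_cpow hs0.le]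
    simp [hs]
  have hs_an : AnalyticAt ℂ s x := by
    refine (analyticAt_const.sub analyticAt_id).cpow analyticAt_const (Or.inl ?_)
    simpa using hx1
  have hal_an : AnalyticAt ℂ (fun lam => (1 + s lam) ^ (3 : ℂ)⁻¹) x := by
    refine (analyticAt_const.add hs_an).cpow analyticAt_const (Or.inl ?_)
    rw [Pi.add_apply, hs_eq, Complex.add_re, Complex.ofReal_re, Complex.one_re]
    positivity
  have hal_eq : (1 + s x) ^ (3 : ℂ)⁻¹ = (realAlpha x : ℝ) := by
    rw [realAlpha, ← ofReal_cpow_third (by positivity), hs_eq]; push_cast; rfl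
  rcases hx0.lt_or_gt with hneg | hpos
  · have h1 : 1 < Real.sqrt (1 - x) := by
      rw [Real.lt_sqrt zero_le_one]; linarith
    refine ⟨s, _, fun lam => -(s lam - 1) ^ (3 : ℂ)⁻¹, fun _ => cpow_half_pow _,
      fun _ => cpow_third_pow _, fun lam => ?_, hs_an, hal_an, ?_, hs_eq, hal_eq, ?_⟩
    · rw [Odd.neg_pow (by decide), cpow_third_pow]; ring
    · refine ((hs_an.sub analyticAt_const).cpow analyticAt_const (Or.inl ?_)).neg
      rw [Pi.sub_apply, hs_eq, Complex.sub_re, Complex.ofReal_re, Complex.one_re]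
      linarith
    · rw [realBeta, if_neg hneg.not_ge, Complex.ofReal_neg, ← ofReal_cpow_third (by linarith), hs_eq]
      push_cast; rfl
  · have h1 : Real.sqrt (1 - x) < 1 := by
      rw [Real.sqrt_lt' one_pos]; linarith
    refine ⟨s, _, fun lam => (1 - s lam) ^ (3 : ℂ)⁻¹, fun _ => cpow_half_pow _,
      fun _ => cpow_third_pow _, fun lam => cpow_third_pow _, hs_an, hal_an, ?_, hs_eq, hal_eq, ?_⟩
    · refine (analyticAt_const.sub hs_an).cpow analyticAt_const (Or.inl ?_)
      rw [Pi.sub_apply, hs_eq, Complex.sub_re, Complex.ofReal_re, Complex.one_re]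
      linarith
    · rw [realBeta, if_pos hpos.le, ← ofReal_cpow_third (by linarith), hs_eq]
      push_cast; rfl

theorem hasSideValues_of_eventually_eq {g f : ℂ → ℂ} {x : ℂ} {U : Set ℂ} (hU : IsOpen U)
    (hf : AnalyticAt ℂ f x) (h : ∀ᶠ lam in 𝓝 x, lam ∈ U → g lam = f lam) :
    HasSideValues g (𝓝[U] x) (f x) (deriv f x) := by
  have heq : ∀ᶠ lam in 𝓝[U] x, g =ᶠ[𝓝 lam] f := by
    rw [eventually_nhdsWithin_iff]
    filter_upwards [eventually_eventually_nhds.2 h] with lam hlam hlU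
    filter_upwards [hlam, hU.mem_nhds hlU] with w hw hwU using hw hwU
  refine ⟨?_, ?_, ?_⟩
  · filter_upwards [heq, nhdsWithin_le_nhds hf.eventually_analyticAt] with lam h1 h2
    exact h1.differentiableAt_iff.2 h2.differentiableAt
  · refine (hf.continuousAt.tendsto.mono_left nhdsWithin_le_nhds).congr' ?_
    filter_upwards [heq] with lam h1 using h1.eq_of_nhds.symm
  · refine (hf.deriv.continuousAt.tendsto.mono_left nhdsWithin_le_nhds).congr' ?_
    filter_upwards [heq] with lam h1 using h1.deriv_eq.symm

namespace IsBranchAt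

variable {s al be : ℂ → ℂ} {x : ℝ}

theorem analyticAt_cubicSol (h : IsBranchAt s al be x) (w : ℂ) :
    AnalyticAt ℂ (fun lam => cubicSol w (al lam) (be lam)) x :=
  analyticAt_const.mul ((h.analytic_al.add (analyticAt_const.mul h.analytic_be)).pow 3)

theorem ne_zero (h : IsBranchAt s al be x) (hx1 : x < 1) (hx0 : x ≠ 0) :
    s x ≠ 0 ∧ al x ≠ 0 ∧ be x ≠ 0 := by
  have hs : s x ≠ 0 := by
    intro h0
    have := h.sq x
    rw [h0] at this
    have h1 : (x : ℂ) = 1 := by linear_combination this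
    exact hx1.ne (by exact_mod_cast h1)
  have hm : al x ^ 3 * be x ^ 3 = x := by
    rw [h.al_pow, h.be_pow]; linear_combination -h.sq x
  have hxc : (x : ℂ) ≠ 0 := by exact_mod_cast hx0
  refine ⟨hs, fun h0 => hxc ?_, fun h0 => hxc ?_⟩
  · rw [← hm, h0]; ring
  · rw [← hm, h0]; ring

/-- The quotient is `3(α' + wβ')/(α + wβ)` with `α' = -1/(6sα²)` and `β' = 1/(6sβ²)`; the
denominator cancels because `wα² - β² = (wα - w²β)(α + wβ)` when `w³ = 1`. -/
theorem deriv_div (h : IsBranchAt s al be x) (hx1 : x < 1) (hx0 : x ≠ 0) {w : ℂ} (hw : w ^ 3 = 1) :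
    deriv (fun lam => cubicSol w (al lam) (be lam)) x / cubicSol w (al x) (be x) =
      (w * al x - w ^ 2 * be x) / (2 * s x * (al x * be x) ^ 2) := by
  obtain ⟨hs, ha, hb⟩ := h.ne_zero hx1 hx0
  have ds := h.analytic_s.differentiableAt.hasDerivAt
  have da := h.analytic_al.differentiableAt.hasDerivAt
  have db := h.analytic_be.differentiableAt.hasDerivAt
  have e1 : 2 * s x * deriv s x = -1 := by
    have h1 := (ds.pow 2).unique (((hasDerivAt_id (x : ℂ)).const_sub 1).congr_of_eventuallyEq
      (Eventually.of_forall h.sq))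
    simpa using h1
  have e2 : 3 * al x ^ 2 * deriv al x = deriv s x := by
    have h1 := (da.pow 3).unique ((ds.const_add 1).congr_of_eventuallyEq
      (Eventually.of_forall h.al_pow))
    simpa using h1
  have e3 : 3 * be x ^ 2 * deriv be x = -deriv s x := by
    have h1 := (db.pow 3).unique ((ds.const_sub 1).congr_of_eventuallyEq
      (Eventually.of_forall h.be_pow))
    simpa using h1
  have hd : deriv (fun lam => cubicSol w (al lam) (be lam)) x =
      -(1 / 2) * (3 * (al x + w * be x) ^ 2 * (deriv al x + w * deriv be x)) := by
    have h1 : HasDerivAt (fun lam => cubicSol w (al lam) (be lam)) _ x :=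
      ((da.add (db.const_mul w)).pow 3).const_mul (-(1 / 2 : ℂ))
    rw [h1.deriv]
    simp
  have hne : al x + w * be x ≠ 0 := by
    intro h0
    have h1 : al x ^ 3 + be x ^ 3 = 2 := by rw [h.al_pow, h.be_pow]; ring
    have h2 : al x ^ 3 + w ^ 3 * be x ^ 3 = 0 := by
      linear_combination (al x ^ 2 - al x * (w * be x) + (w * be x) ^ 2) * h0
    rw [hw, one_mul, h1] at h2
    norm_num at h2
  rw [hd, cubicSol]
  have e2' : deriv al x = -1 / (6 * s x * al x ^ 2) := by
    rw [eq_div_iff (mul_ne_zero (mul_ne_zero (by norm_num) hs) (pow_ne_zero 2 ha))]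
    linear_combination 2 * s x * e2 + e1
  have e3' : deriv be x = 1 / (6 * s x * be x ^ 2) := by
    rw [eq_div_iff (mul_ne_zero (mul_ne_zero (by norm_num) hs) (pow_ne_zero 2 hb))]
    linear_combination 2 * s x * e3 - e1
  rw [e2', e3']
  generalize al x = a at *
  generalize be x = b at *
  generalize s x = σ at *
  field_simp
  linear_combination 6 * b ^ 2 * hw

theorem tendsto_mul_star (h : IsBranchAt s al be x) :
    Tendsto (fun lam => al lam * star (be lam)) (𝓝 (x : ℂ))
      (𝓝 ((realAlpha x * realBeta x : ℝ) : ℂ)) := by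
  have h1 := h.analytic_al.continuousAt.mul (continuous_star.continuousAt.comp
    h.analytic_be.continuousAt)
  have h2 : al x * star (be x) = ((realAlpha x * realBeta x : ℝ) : ℂ) := by
    rw [h.al_eq, h.be_eq]; simp
  rw [← h2]
  exact h1

/-- Near a real point `x < 1`, `x ≠ 0`, the sign of `Im (α conj β)` is opposite to that of
`Im λ`. -/
theorem eventually_im_neg (h : IsBranchAt s al be x) (hx1 : x < 1) (hx0 : x ≠ 0) :
    ∀ᶠ lam in 𝓝 (x : ℂ), (lam ∈ upperHalf → (al lam * star (be lam)).im < 0) ∧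
      (lam ∈ lowerHalf → 0 < (al lam * star (be lam)).im) := by
  have hre := (Complex.continuous_re.tendsto _).comp h.tendsto_mul_star
  have him := (Complex.continuous_im.tendsto _).comp h.tendsto_mul_star
  have hs : Tendsto (fun lam => (s lam).re) (𝓝 (x : ℂ)) (𝓝 (Real.sqrt (1 - x))) := by
    have := (Complex.continuous_re.tendsto _).comp h.analytic_s.continuousAt.tendsto
    rw [h.s_eq] at this
    exact this
  have hP : realAlpha x * realBeta x ≠ 0 := by
    intro h0
    have := realAlpha_mul_realBeta_pow hx1.le
    rw [h0] at this
    exact hx0 (by rw [← this]; norm_num)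
  have hq := ((hre.pow 2).const_mul 3).sub (him.pow 2)
  have hq0 : (0 : ℝ) < 3 * ((realAlpha x * realBeta x : ℝ) : ℂ).re ^ 2 -
      ((realAlpha x * realBeta x : ℝ) : ℂ).im ^ 2 := by
    rw [Complex.ofReal_re, Complex.ofReal_im]
    have : 0 < (realAlpha x * realBeta x) ^ 2 := by positivity
    linarith
  filter_upwards [hs.eventually_const_lt (Real.sqrt_pos.2 (sub_pos.2 hx1)),
    hq.eventually_const_lt hq0] with lam h1 h2
  simp only [Function.comp_apply] at h2
  -- Near `x` the factor `3 (Re P)² - (Im P)²` is positive, so `Im P` has the sign of `Im s`; and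
  -- `Re s > 0` with `2 Re s Im s = -Im λ` makes that sign opposite to the one of `Im λ`.
  have key := im_mul_star_mul (h.al_pow lam) (h.be_pow lam)
  have hsq : 2 * (s lam).re * (s lam).im = -lam.im := by
    have := congrArg Complex.im (h.sq lam)
    rw [pow_two, Complex.mul_im, Complex.sub_im, Complex.one_im] at this
    linarith
  constructor
  · intro hl
    have hl' : 0 < lam.im := hl
    by_contra! hc
    have h4 : 0 ≤ (s lam).im := by linarith [mul_nonneg hc h2.le]
    linarith [mul_nonneg h1.le h4]
  · intro hl
    have hl' : lam.im < 0 := hl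
    by_contra! hc
    have h4 : (s lam).im ≤ 0 := by linarith [mul_nonpos_of_nonpos_of_nonneg hc h2.le]
    linarith [mul_nonpos_of_nonneg_of_nonpos h1.le h4]

end IsBranchAt

/-! ### Labelling the ordered solutions on each side of the axis -/

theorem eq_of_sorted_triple {α : Type*} {f : α → ℝ} {x y w a b c : α}
    (h : ({x, y, w} : Multiset α) = {a, b, c} ∧ f x ≤ f y ∧ f y ≤ f w) {a' b' c' : α}
    (h' : ({a, b, c} : Multiset α) = {a', b', c'}) (hab : f a' < f b') (hbc : f b' < f c') :
    x = a' ∧ y = b' ∧ w = c' := by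
  obtain ⟨hm, hxy, hyw⟩ := h
  rcases triple_eq_triple (hm.trans h') with h | h | h | h | h | h <;>
    obtain ⟨rfl, rfl, rfl⟩ := h <;> first | exact ⟨rfl, rfl, rfl⟩ | (exfalso; linarith)

theorem triple_rotate {α : Type*} (a b c : α) : ({a, b, c} : Multiset α) = {b, c, a} :=
  (Multiset.cons_swap a b {c}).trans (congrArg (b ::ₘ ·) (Multiset.pair_comm a c))

theorem triple_swap {α : Type*} (a b c : α) : ({a, b, c} : Multiset α) = {a, c, b} :=
  congrArg (a ::ₘ ·) (Multiset.pair_comm b c)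

theorem triple_reverse {α : Type*} (a b c : α) : ({a, b, c} : Multiset α) = {c, b, a} :=
  (triple_rotate a b c).trans ((triple_rotate b c a).trans (triple_swap c a b))

namespace IsOrderedSolutions

variable {z : ℤ → ℂ → ℂ} {s al be : ℂ → ℂ} {x : ℝ}

/-- `P` stays near a positive number, so `w = 1` gives the largest modulus; the sign of `Im P` picks
the smallest of the other two. -/
theorem eventually_of_pos (hz : IsOrderedSolutions 2 1 cubicSymbol z)
    (h : IsBranchAt s al be x) (hx1 : x < 1) (hx0 : 0 < x) :
    ∀ᶠ lam in 𝓝 (x : ℂ),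
      (lam ∈ upperHalf → z 1 lam = cubicSol cubeRoot (al lam) (be lam)) ∧
      (lam ∈ lowerHalf → z 1 lam = cubicSol (cubeRoot ^ 2) (al lam) (be lam)) := by
  have hre := ((Complex.continuous_re.tendsto _).comp h.tendsto_mul_star).const_mul 3
  have him := ((Complex.continuous_im.tendsto _).comp h.tendsto_mul_star).const_mul (Real.sqrt 3)
  have hP := (realAlpha_mul_realBeta_pos hx1.le).2 hx0
  have l1 := him.eventually_lt hre
    (by rw [Complex.ofReal_re, Complex.ofReal_im, mul_zero]; positivity)
  have l2 := him.neg.eventually_lt hre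
    (by rw [Complex.ofReal_re, Complex.ofReal_im, mul_zero, neg_zero]; positivity)
  have h3 : 0 < Real.sqrt 3 := by positivity
  filter_upwards [l1, l2, h.eventually_im_neg hx1 hx0.ne'] with lam h1 h2 him
  have ht := hz.triple (h.sq lam) (h.al_pow lam) (h.be_pow lam)
  exact ⟨fun hl => (eq_of_sorted_triple (f := norm) ht (triple_rotate _ _ _)
      (norm_cubicSol_one_lt_two.2 (mul_neg_of_pos_of_neg h3 (him.1 hl)))
      (norm_cubicSol_two_lt_zero.2 h2)).1,
    fun hl => (eq_of_sorted_triple (f := norm) ht (triple_reverse _ _ _)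
      (norm_cubicSol_two_lt_one.2 (mul_pos h3 (him.2 hl)))
      (norm_cubicSol_one_lt_zero.2 h1)).1⟩

/-- `P` stays near a negative number, so `w = 1` gives the smallest modulus on both sides: `z 1`
will have no jump. -/
theorem eventually_of_neg (hz : IsOrderedSolutions 2 1 cubicSymbol z)
    (h : IsBranchAt s al be x) (hx0 : x < 0) :
    ∀ᶠ lam in 𝓝 (x : ℂ),
      (lam ∈ upperHalf → z 1 lam = cubicSol 1 (al lam) (be lam) ∧
        z 2 lam = cubicSol cubeRoot (al lam) (be lam)) ∧
      (lam ∈ lowerHalf → z 1 lam = cubicSol 1 (al lam) (be lam) ∧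
        z 2 lam = cubicSol (cubeRoot ^ 2) (al lam) (be lam)) := by
  have hx1 : x < 1 := hx0.trans one_pos
  have hre := ((Complex.continuous_re.tendsto _).comp h.tendsto_mul_star).const_mul 3
  have him := ((Complex.continuous_im.tendsto _).comp h.tendsto_mul_star).const_mul (Real.sqrt 3)
  have hP := (realAlpha_mul_realBeta_neg hx1.le).2 hx0
  have l1 := hre.eventually_lt him
    (by rw [Complex.ofReal_re, Complex.ofReal_im, mul_zero]; linarith)
  have l2 := hre.eventually_lt him.neg
    (by rw [Complex.ofReal_re, Complex.ofReal_im, mul_zero, neg_zero]; linarith)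
  have h3 : 0 < Real.sqrt 3 := by positivity
  filter_upwards [l1, l2, h.eventually_im_neg hx1 hx0.ne] with lam h1 h2 him
  have ht := hz.triple (h.sq lam) (h.al_pow lam) (h.be_pow lam)
  refine ⟨fun hl => ?_, fun hl => ?_⟩
  · have := eq_of_sorted_triple (f := norm) ht rfl (norm_cubicSol_zero_lt_one.2 h1)
      (norm_cubicSol_one_lt_two.2 (mul_neg_of_pos_of_neg h3 (him.1 hl)))
    exact ⟨this.1, this.2.1⟩
  · have := eq_of_sorted_triple (f := norm) ht (triple_swap _ _ _) (norm_cubicSol_zero_lt_two.2 h2)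
      (norm_cubicSol_two_lt_one.2 (mul_pos h3 (him.2 hl)))
    exact ⟨this.1, this.2.1⟩

end IsOrderedSolutions

/-! ### The jumps and the densities -/

/-- The common form of the densities of `μ_0` and `μ_1`. -/
noncomputable def cubicDensity (x : ℝ) : ℝ :=
  Real.sqrt 3 * (realAlpha x + realBeta x) /
    (4 * Real.pi * Real.sqrt (1 - x) * (realAlpha x * realBeta x) ^ 2)

/-- In the difference of the two logarithmic derivatives `ω - ω² = i√3` factors out, leaving `α +
β`; its `i` cancels the one in `2πi`. -/
theorem IsBranchAt.ofReal_cubicDensity {s al be : ℂ → ℂ} {x : ℝ} (h : IsBranchAt s al be x)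
    (hx1 : x < 1) (hx0 : x ≠ 0) : (cubicDensity x : ℂ) = 1 / (2 * (Real.pi : ℂ) * Complex.I) *
      (deriv (fun lam => cubicSol cubeRoot (al lam) (be lam)) x /
          cubicSol cubeRoot (al x) (be x) -
        deriv (fun lam => cubicSol (cubeRoot ^ 2) (al lam) (be lam)) x /
          cubicSol (cubeRoot ^ 2) (al x) (be x)) := by
  have h3 := cubeRoot_pow_three
  obtain ⟨hs, ha, hb⟩ := h.ne_zero hx1 hx0
  rw [h.deriv_div hx1 hx0 h3, h.deriv_div hx1 hx0 (by linear_combination (cubeRoot ^ 3 + 1) * h3)]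
  have e : (cubeRoot * al x - cubeRoot ^ 2 * be x) -
      (cubeRoot ^ 2 * al x - (cubeRoot ^ 2) ^ 2 * be x) =
      Complex.I * (Real.sqrt 3 : ℂ) * (al x + be x) := by
    rw [← cubeRoot_sub_sq]; linear_combination cubeRoot * be x * h3
  rw [← sub_div, e, cubicDensity]
  push_cast
  rw [← h.al_eq, ← h.be_eq, ← h.s_eq]
  have hpi : (Real.pi : ℂ) ≠ 0 := by exact_mod_cast Real.pi_ne_zero
  field_simp [Complex.I_ne_zero]
  norm_num

theorem IsOrderedSolutions.hasRealJump_zero {z : ℤ → ℂ → ℂ}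
    (hz : IsOrderedSolutions 2 1 cubicSymbol z) {x : ℝ} (hx1 : x < 1) (hx0 : 0 < x) :
    HasRealJump 1 z 0 x (cubicDensity x) := by
  obtain ⟨s, al, be, h⟩ := exists_isBranchAt hx1 hx0.ne'
  have hev := hz.eventually_of_pos h hx1 hx0
  have hI : Finset.Icc (1 : ℤ) (((1 : ℕ) : ℤ) + 0) = {1} := by decide
  set F : ℂ → ℂ → ℂ := fun w lam => cubicSol w (al lam) (be lam)
  refine ⟨fun _ => F cubeRoot x, fun _ => deriv (F cubeRoot) x, fun _ => F (cubeRoot ^ 2) x,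
    fun _ => deriv (F (cubeRoot ^ 2)) x, fun j hj => ?_, ?_⟩
  · rw [hI, Finset.mem_singleton] at hj
    subst hj
    exact ⟨hasSideValues_of_eventually_eq isOpen_upperHalf (h.analyticAt_cubicSol cubeRoot)
        (hev.mono fun _ h => h.1),
      hasSideValues_of_eventually_eq isOpen_lowerHalf (h.analyticAt_cubicSol (cubeRoot ^ 2))
        (hev.mono fun _ h => h.2)⟩
  · rw [hI, Finset.sum_singleton]
    exact h.ofReal_cubicDensity hx1 hx0.ne'

theorem IsOrderedSolutions.hasRealJump_one {z : ℤ → ℂ → ℂ}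
    (hz : IsOrderedSolutions 2 1 cubicSymbol z) {x : ℝ} (hx0 : x < 0) :
    HasRealJump 1 z 1 x (cubicDensity x) := by
  have hx1 : x < 1 := hx0.trans one_pos
  obtain ⟨s, al, be, h⟩ := exists_isBranchAt hx1 hx0.ne
  have hev := hz.eventually_of_neg h hx0
  have hI : Finset.Icc (1 : ℤ) (((1 : ℕ) : ℤ) + 1) = {1, 2} := by decide
  set F : ℂ → ℂ → ℂ := fun w lam => cubicSol w (al lam) (be lam)
  refine ⟨fun j => if j = 1 then F 1 x else F cubeRoot x,
    fun j => if j = 1 then deriv (F 1) x else deriv (F cubeRoot) x,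
    fun j => if j = 1 then F 1 x else F (cubeRoot ^ 2) x,
    fun j => if j = 1 then deriv (F 1) x else deriv (F (cubeRoot ^ 2)) x, fun j hj => ?_, ?_⟩
  · rw [hI, Finset.mem_insert, Finset.mem_singleton] at hj
    rcases hj with rfl | rfl
    · simp only [if_true]
      exact ⟨hasSideValues_of_eventually_eq isOpen_upperHalf (h.analyticAt_cubicSol 1)
          (hev.mono fun _ h hl => (h.1 hl).1),
        hasSideValues_of_eventually_eq isOpen_lowerHalf (h.analyticAt_cubicSol 1)
          (hev.mono fun _ h hl => (h.2 hl).1)⟩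
    · simp only [show (2 : ℤ) ≠ 1 by decide, if_false]
      exact ⟨hasSideValues_of_eventually_eq isOpen_upperHalf (h.analyticAt_cubicSol cubeRoot)
          (hev.mono fun _ h hl => (h.1 hl).2),
        hasSideValues_of_eventually_eq isOpen_lowerHalf (h.analyticAt_cubicSol (cubeRoot ^ 2))
          (hev.mono fun _ h hl => (h.2 hl).2)⟩
  · rw [hI, Finset.sum_pair (by decide)]
    simp only [show (2 : ℤ) ≠ 1 by decide, if_false, if_true, sub_self, zero_add]
    exact h.ofReal_cubicDensity hx1 hx0.ne

theorem cubicDensity_nonneg (x : ℝ) : 0 ≤ cubicDensity x := by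
  have h : 0 ≤ realAlpha x + realBeta x := by
    have h1 : -realBeta x ≤ realAlpha x := by
      -- Cubing reduces `-β ≤ α` to `√(1 - x) - 1 ≤ 1 + √(1 - x)`.
      rw [← (show Odd 3 by decide).pow_le_pow, Odd.neg_pow (by decide), realAlpha_pow,
        realBeta_pow]
      linarith [Real.sqrt_nonneg (1 - x)]
    linarith
  have := Real.pi_pos
  unfold cubicDensity
  positivity

theorem sq_rpow_third {r : ℝ} (hr : 0 ≤ r) : (r ^ (1 / 3 : ℝ)) ^ 2 = r ^ (2 / 3 : ℝ) := by
  rw [← Real.rpow_natCast, ← Real.rpow_mul hr]; norm_num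

theorem cubicDensity_of_nonneg {x : ℝ} (hx0 : 0 ≤ x) (hx1 : x ≤ 1) : cubicDensity x =
    Real.sqrt 3 / (4 * Real.pi) *
      (((1 + Real.sqrt (1 - x)) ^ (1 / 3 : ℝ) + (1 - Real.sqrt (1 - x)) ^ (1 / 3 : ℝ)) /
        (x ^ (2 / 3 : ℝ) * Real.sqrt (1 - x))) := by
  have h : (realAlpha x * realBeta x) ^ 2 = x ^ (2 / 3 : ℝ) := by
    have h1 : 0 ≤ 1 - Real.sqrt (1 - x) := by
      rw [sub_nonneg, Real.sqrt_le_one]; linarith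
    rw [realAlpha, realBeta, if_pos hx0, ← Real.mul_rpow (by positivity) h1, ← sq_rpow_third hx0]
    congr 2
    linear_combination -Real.sq_sqrt (sub_nonneg.2 hx1)
  rw [cubicDensity, h, realAlpha, realBeta, if_pos hx0, div_mul_div_comm]
  congr 1
  ring

theorem cubicDensity_of_neg {x : ℝ} (hx0 : x < 0) : cubicDensity x =
    Real.sqrt 3 / (4 * Real.pi) *
      (((1 + Real.sqrt (1 - x)) ^ (1 / 3 : ℝ) - (Real.sqrt (1 - x) - 1) ^ (1 / 3 : ℝ)) /
        ((-x) ^ (2 / 3 : ℝ) * Real.sqrt (1 - x))) := by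
  have h : (realAlpha x * realBeta x) ^ 2 = (-x) ^ (2 / 3 : ℝ) := by
    have h1 : 0 ≤ Real.sqrt (1 - x) - 1 := by
      rw [sub_nonneg, Real.one_le_sqrt]; linarith
    rw [realAlpha, realBeta, if_neg hx0.not_ge, mul_neg, neg_sq,
      ← Real.mul_rpow (by positivity) h1, ← sq_rpow_third (neg_nonneg.2 hx0.le)]
    congr 2
    linear_combination Real.sq_sqrt (sub_nonneg.2 (hx0.le.trans zero_le_one))
  rw [cubicDensity, h, realAlpha, realBeta, if_neg hx0.not_ge, div_mul_div_comm, ← sub_eq_add_neg]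
  congr 1
  ring

/-! ### Arcs covering the interiors, and conclusion -/

theorem isEmbedding_of_leftInvOn {γ : ℝ → ℂ} {g : ℂ → ℝ} {s : Set ℝ} (hγ : ContinuousOn γ s)
    (hg : Continuous g) (h : ∀ t ∈ s, g (γ t) = t) : IsEmbedding (s.domRestrict γ) := by
  refine IsEmbedding.of_comp hγ.domRestrict hg ?_
  have : g ∘ s.domRestrict γ = Subtype.val := funext fun t => h t t.2
  rw [this]
  exact IsEmbedding.subtypeVal

theorem isAnalyticArc_ofReal : IsAnalyticArc (fun t : ℝ => (t : ℂ)) where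
  analytic t _ := Complex.ofRealCLM.analyticAt t
  deriv_ne_zero t _ := by
    rw [((hasDerivAt_id' t).ofReal_comp).deriv]; simp
  embedding := isEmbedding_of_leftInvOn Complex.continuous_ofReal.continuousOn
    Complex.continuous_re fun t _ => Complex.ofReal_re t

/-- Arcs are parametrized by `(0, 1)`, and `Real.log` carries this interval onto the unbounded `(-∞,
0)`. -/
theorem isAnalyticArc_log : IsAnalyticArc (fun t : ℝ => (Real.log t : ℂ)) where
  analytic t ht := (Complex.ofRealCLM.analyticAt _).comp (analyticAt_id.log ht.1)
  deriv_ne_zero t ht := by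
    rw [(Real.hasDerivAt_log ht.1.ne').ofReal_comp.deriv]
    simpa using ht.1.ne'
  embedding := isEmbedding_of_leftInvOn (g := fun w => Real.exp w.re)
    (Complex.continuous_ofReal.comp_continuousOn
      (Real.continuousOn_log.mono fun t ht => ht.1.ne'))
    (Real.continuous_exp.comp Complex.continuous_re)
    fun t ht => by rw [Complex.ofReal_re, Real.exp_log ht.1]

theorem log_image_Ioo : Real.log '' Ioo 0 1 = Iio 0 := by
  ext x
  constructor
  · rintro ⟨t, ht, rfl⟩
    exact Real.log_neg ht.1 ht.2
  · intro hx
    exact ⟨Real.exp x, ⟨Real.exp_pos x, by simpa using hx⟩, Real.log_exp x⟩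

theorem realDensityMeasure_congr {S : Set ℝ} (hS : MeasurableSet S) {f g : ℝ → ℝ}
    (h : ∀ᵐ x, x ∈ S → f x = g x) : realDensityMeasure S f = realDensityMeasure S g := by
  unfold realDensityMeasure
  congr 1
  refine withDensity_congr_ae ((ae_restrict_iff' hS).2 ?_)
  filter_upwards [h] with x hx hxS
  rw [hx hxS]

end BandedToeplitz

theorem mainTheorem5 :
    BandedToeplitz.IsBandedSymbol 2 1 BandedToeplitz.cubicSymbol ∧
    (∃ z : ℤ → ℂ → ℂ, BandedToeplitz.IsOrderedSolutions 2 1 BandedToeplitz.cubicSymbol z) ∧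
    ∀ z : ℤ → ℂ → ℂ, BandedToeplitz.IsOrderedSolutions 2 1 BandedToeplitz.cubicSymbol z →
      (BandedToeplitz.Gam 1 z 0 = (fun x : ℝ => (x : ℂ)) '' Set.Icc 0 1 ∧
        ∀ μ : MeasureTheory.Measure ℂ, BandedToeplitz.IsMu 1 z 0 μ ↔
          μ = BandedToeplitz.realDensityMeasure (Set.Icc 0 1) (fun x =>
            Real.sqrt 3 / (4 * Real.pi) *
              (((1 + Real.sqrt (1 - x)) ^ (1 / 3 : ℝ) + (1 - Real.sqrt (1 - x)) ^ (1 / 3 : ℝ)) /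
                (x ^ (2 / 3 : ℝ) * Real.sqrt (1 - x))))) ∧
      (BandedToeplitz.Gam 1 z 1 = (fun x : ℝ => (x : ℂ)) '' Set.Iic 0 ∧
        ∀ μ : MeasureTheory.Measure ℂ, BandedToeplitz.IsMu 1 z 1 μ ↔
          μ = BandedToeplitz.realDensityMeasure (Set.Iic 0) (fun x =>
            Real.sqrt 3 / (4 * Real.pi) *
              (((1 + Real.sqrt (1 - x)) ^ (1 / 3 : ℝ) - (Real.sqrt (1 - x) - 1) ^ (1 / 3 : ℝ)) /
                ((-x) ^ (2 / 3 : ℝ) * Real.sqrt (1 - x))))) := by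
  open BandedToeplitz Set in
  refine ⟨isBandedSymbol_cubicSymbol, exists_isOrderedSolutions, fun z hz =>
    ⟨⟨hz.gam_zero, fun μ => ?_⟩, hz.gam_one, fun μ => ?_⟩⟩
  · rw [isMu_iff_eq_realDensityMeasure (f := cubicDensity) hz.gam_zero ?_
      (fun x _ => cubicDensity_nonneg x) ?_ isAnalyticArc_ofReal ?_,
      realDensityMeasure_congr measurableSet_Icc
        (Filter.Eventually.of_forall fun x hx => cubicDensity_of_nonneg hx.1 hx.2)]
    · rw [interior_Icc]
      exact fun x hx => hz.hasRealJump_zero hx.2 hx.1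
    · rw [interior_Icc, Icc_sdiff_Ioo_same zero_le_one]
      exact toFinite _
    · rw [interior_Icc]
  · rw [isMu_iff_eq_realDensityMeasure (f := cubicDensity) hz.gam_one ?_
      (fun x _ => cubicDensity_nonneg x) ?_ isAnalyticArc_log ?_,
      realDensityMeasure_congr measurableSet_Iic ?_]
    -- `cubicDensity_of_neg` needs `x < 0`; the endpoint `0` is a null set.
    · filter_upwards [MeasureTheory.Measure.ae_ne MeasureTheory.volume 0] with x hx hx0
      exact cubicDensity_of_neg (lt_of_le_of_ne hx0 hx)
    · rw [interior_Iic]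
      exact fun x hx => hz.hasRealJump_one hx
    · rw [interior_Iic, Iic_sdiff_Iio_same]
      exact toFinite _
    · rw [interior_Iic, ← log_image_Ioo, image_image]
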